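/- **Slater determinant model.** For $m\ge 0$ let $\gamma_m(\zeta)=(\pi\, m!)^{-1/2}\,\overline{\zeta}^{\,m}e^{-|\zeta|^2/2}$, $\zeta\in\mathbb C$, be the Landau states of the lowest Landau band (field strength scaled to $1$), and for $N\ge 1$ let $$\Upsilon_N(\zeta_1,\dots,\zeta_N)=\frac1{\sqrt{N!}}\det\big(\gamma_{k-1}(\zeta_j)\big)_{j,k=1}^N .$$ Define the effective one-dimensional potentials $$V_j(x)=\int_{\mathbb C^N}\frac{|\Upsilon_N(\zeta)|^2}{\sqrt{x^2+|\zeta_j|^2}}\,d\zeta,\qquad W_{jk}(x)=\int_{\mathbb C^N}\frac{|\Upsilon_N(\zeta)|^2}{\sqrt{x^2+|\zeta_j-\zeta_k|^2}}\,d\zeta\quad(j\ne k),$$ and, for $Z,B>0$, the Hamiltonian on $L^2(\mathbb R^N)$ $$h^{\rm det}(N,Z,B^{-1/2})=\sum_{j=1}^N\Big[-\sqrt B\,\frac{d^2}{dx_j^2}-Z\,V_j(x_j)\Big]+\sum_{1\le j<k\le N}W_{jk}(x_j-x_k).$$ Its ground state energy is the infimum of $\langle\Phi,h\Phi\rangle$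 over $\Phi\in C_c^\infty(\mathbb R^N)$ with $\|\Phi\|_{L^2}=1$. We say that $h^{\rm det}(N,Z,B^{-1/2})$ has a bound state if this ground state energy is strictly smaller than the ground state energy of the $(N-1)$-electron Hamiltonian obtained from it by omitting all terms that involve one of the variables $x_i$ (keeping the potentials $V_j,W_{jk}$ of $\Upsilon_N$; by antisymmetry of $\Upsilon_N$ the choice of $i$ does not matter, and for $N=1$ the latter energy is $0$). Let $N_{\max}(Z,B)$ be the largest $N\ge1$ for which $h^{\rm det}(N,Z,B^{-1/2})$ has a bound state (and $0$ if there is none). Then: 1. For all constants $a_1,a_2>0$ and every $\alpha>0$ there is a constant $A_\alpha>0$ such that for every $\varepsilon>0$, every real $Z\ge1$ and every $B$ with $a_1e^{Z^{\alpha/4}}>B\ge a_2Z^{3+\varepsilon}$, the number $N_{\max}(Z,B)$ is finite and $$N_{\max}(Z,B)\le 4Z+A_\alpha Z^{1+\alpha}.$$ 2. For all $a>0$ and $p>3$ there is a constant $A>0$ (depending on $a,p$) such that for every real $Z\ge2$ and $B=aZ^p$, the number $N_{\max}(Z,B)$ is finite and $$N_{\max}(Z,B)\le 6Z+A\,Z(\log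 Z)^2 .$$ -/

import Mathlib

open MeasureTheory
open scoped ContDiff

namespace SlaterModel

/-- The Landau state of angular momentum `-m` in the lowest Landau band, in the
variable `ζ = y + i z` and for field strength `1` (the field strength is scaled out):
`γ_m(ζ) = (π m!)^{-1/2} conj(ζ)^m exp(-|ζ|²/2)`. -/
noncomputable def landau (m : ℕ) (ζ : ℂ) : ℂ :=
  (((Real.sqrt (Real.pi * (m.factorial : ℝ)))⁻¹ * Real.exp (-(‖ζ‖ ^ 2) / 2) : ℝ) : ℂ)
    * (starRingEnd ℂ ζ) ^ m

/-- The Slater determinant `Υ = (N!)^{-1/2} γ_0 ∧ ⋯ ∧ γ_{N-1}`. -/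
noncomputable def slater (N : ℕ) (ζ : Fin N → ℂ) : ℂ :=
  (((Real.sqrt (N.factorial : ℝ))⁻¹ : ℝ) : ℂ)
    * Matrix.det (Matrix.of fun j k : Fin N => landau (k : ℕ) (ζ j))

/-- Effective one-dimensional nuclear potential of an `N`-particle state `U` of the transverse
variables: `⟨U, |r_j|⁻¹ U⟩`, where `|r_j| = (x² + |ζ_j|²)^{1/2}`. -/
noncomputable def effV {N : ℕ} (U : (Fin N → ℂ) → ℂ) (j : Fin N) (x : ℝ) : ℝ :=
  ∫ ζ : Fin N → ℂ, ‖U ζ‖ ^ 2 / Real.sqrt (x ^ 2 + ‖ζ j‖ ^ 2)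

/-- Effective one-dimensional pair interaction of the state `U`: `⟨U, |r_j - r_k|⁻¹ U⟩`,
as a function of the longitudinal separation `x = x_j - x_k`. -/
noncomputable def effW {N : ℕ} (U : (Fin N → ℂ) → ℂ) (j k : Fin N) (x : ℝ) : ℝ :=
  ∫ ζ : Fin N → ℂ, ‖U ζ‖ ^ 2 / Real.sqrt (x ^ 2 + ‖ζ j - ζ k‖ ^ 2)

section Hamiltonian

variable {ι : Type} [Fintype ι] [LinearOrder ι]

/-- The potential `-Z ∑_j V_j(x_j) + ∑_{j<k} W_{jk}(x_j - x_k)`, for particles labelled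
by `ι`. -/
noncomputable def potential (Z : ℝ) (V : ι → ℝ → ℝ) (W : ι → ι → ℝ → ℝ) (x : ι → ℝ) : ℝ :=
  -Z * ∑ j, V j (x j) + ∑ j, ∑ k, if j < k then W j k (x j - x k) else 0

/-- The quadratic form `⟨Φ, h Φ⟩` of
`h = ∑_j [-M⁻¹ d²/dx_j² - Z V_j(x_j)] + ∑_{j<k} W_{jk}(x_j - x_k)`. -/
noncomputable def energy (Z M : ℝ) (V : ι → ℝ → ℝ) (W : ι → ι → ℝ → ℝ)
    (Φ : (ι → ℝ) → ℂ) : ℝ :=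
  ∫ x : ι → ℝ, ((1 / M) * ∑ j, ‖fderiv ℝ Φ x (Pi.single j 1)‖ ^ 2
    + potential Z V W x * ‖Φ x‖ ^ 2)

/-- The ground state energy of `h`: the infimum of `⟨Φ, h Φ⟩` over normalized `Φ`
in `C_c^∞`. For bounded potentials this is a form core, so this is the bottom of the
spectrum of `h`. -/
noncomputable def groundEnergy (Z M : ℝ) (V : ι → ℝ → ℝ) (W : ι → ι → ℝ → ℝ) : ℝ :=
  sInf {E : ℝ | ∃ Φ : (ι → ℝ) → ℂ, ContDiff ℝ ∞ Φ ∧ HasCompactSupport Φ ∧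
    ∫ x : ι → ℝ, ‖Φ x‖ ^ 2 = 1 ∧ E = energy Z M V W Φ}

end Hamiltonian

/-- Ground state energy of the `N`-electron Hamiltonian `h^det(N, Z, M)`. -/
noncomputable def detEnergy (N : ℕ) (Z M : ℝ) : ℝ :=
  groundEnergy Z M (effV (slater N)) (effW (slater N))

/-- Ground state energy of the `(N-1)`-electron Hamiltonian obtained from `h^det(N, Z, M)` by
omitting all terms that involve the variable `x_i`, the effective potentials still being those
of the `N`-particle determinant. -/
noncomputable def detEnergyOmit (N : ℕ) (i : Fin N) (Z M : ℝ) : ℝ :=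
  groundEnergy (ι := {j : Fin N // j ≠ i}) Z M (fun j => effV (slater N) j)
    (fun j k => effW (slater N) j k)

/-- The numbers `N ≥ 1` of electrons for which `h^det(N, Z, B^{-1/2})` has a bound state:
its ground state energy is strictly below that of the system with one electron removed.
(By antisymmetry of the determinant, the latter does not depend on the removed electron `i`.) -/
def boundNumbers (Z B : ℝ) : Set ℕ :=
  {N : ℕ | 1 ≤ N ∧ ∀ i : Fin N,
    detEnergy N Z (B ^ (-(1 / 2) : ℝ)) < detEnergyOmit N i Z (B ^ (-(1 / 2) : ℝ))}

/-- `N_max(Z, B)`: the largest number of electrons that can be bound (meaningful when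
`boundNumbers Z B` is bounded). -/
noncomputable def Nmax (Z B : ℝ) : ℕ := sSup (boundNumbers Z B)

end SlaterModel

/-!
A near minimizer `Φ` of the `n`-particle energy almost satisfies its Euler-Lagrange equation,
which is tested, as in Lieb's bound on the maximal negative ionization, against `G Φ` with
`G = ∑ i, √(x i ^ 2 + n)`, made bounded by a small parameter. If no particle can be removed
without raising the energy, then the weighted repulsion minus the weighted attraction is at most
the error `M⁻¹ ∑ j, ∫ |Φ| |∂_j Φ|`, with `M = B ^ (-1 / 2)`, produced by the derivatives of `G`.
The effective potentials satisfy `V ≤ 4 / √(x² + n)`, because the densities of the first `n`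
Landau states add up to at most `1 / π`, and `W ≥ 1 / √(x² + 4 n)`, by convexity. As
`√((t - u)² + 4 n) ≤ √(t² + n) + √(u² + n)`, each pair contributes at least a constant, whereas
the attraction contributes at most `4 Z n`.

The error is controlled by the kinetic energy. Up to a remainder of order `exp (-S)`, the
potential `1 / √(1 + x²)` is the derivative of a function bounded by `2 S`, so that for `S` of
order `log B` a state of nonpositive energy has kinetic energy `O(n (Z S)² M)` and error
`O(n Z S)`. This yields `n = O(Z S)`.
-/

namespace SlaterModel

/-- Bounded measurable real functions: the potentials and multipliers for which every term of the
quadratic form is integrable on test functions. -/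
structure IsBoundedMeasurable {α : Type*} [MeasurableSpace α] (f : α → ℝ) : Prop where
  measurable : Measurable f
  exists_abs_le : ∃ D, ∀ x, |f x| ≤ D

namespace IsBoundedMeasurable

variable {α β : Type*} [MeasurableSpace α] [MeasurableSpace β] {f g : α → ℝ}

theorem const (c : ℝ) : IsBoundedMeasurable fun _ : α => c :=
  ⟨measurable_const, |c|, fun _ => le_rfl⟩

theorem of_nonneg_of_le {D : ℝ} (hf : Measurable f) (h₀ : ∀ x, 0 ≤ f x) (hD : ∀ x, f x ≤ D) :
    IsBoundedMeasurable f :=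
  ⟨hf, D, fun x => (abs_of_nonneg (h₀ x)).trans_le (hD x)⟩

theorem add (hf : IsBoundedMeasurable f) (hg : IsBoundedMeasurable g) :
    IsBoundedMeasurable fun x => f x + g x := by
  obtain ⟨C, hC⟩ := hf.exists_abs_le
  obtain ⟨D, hD⟩ := hg.exists_abs_le
  exact ⟨hf.measurable.add hg.measurable, C + D, fun x =>
    (abs_add_le _ _).trans (add_le_add (hC x) (hD x))⟩

theorem mul (hf : IsBoundedMeasurable f) (hg : IsBoundedMeasurable g) :
    IsBoundedMeasurable fun x => f x * g x := by
  obtain ⟨C, hC⟩ := hf.exists_abs_le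
  obtain ⟨D, hD⟩ := hg.exists_abs_le
  refine ⟨hf.measurable.mul hg.measurable, C * D, fun x => ?_⟩
  rw [abs_mul]
  exact mul_le_mul (hC x) (hD x) (abs_nonneg _) ((abs_nonneg _).trans (hC x))

theorem sum {κ : Type*} (s : Finset κ) {f : κ → α → ℝ} (hf : ∀ k, IsBoundedMeasurable (f k)) :
    IsBoundedMeasurable fun x => ∑ k ∈ s, f k x := by
  choose D hD using fun k => (hf k).exists_abs_le
  exact ⟨Finset.measurable_sum s fun k _ => (hf k).measurable, ∑ k ∈ s, D k, fun x =>
    (Finset.abs_sum_le_sum_abs _ _).trans (Finset.sum_le_sum fun k _ => hD k x)⟩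

theorem comp (hf : IsBoundedMeasurable f) {g : β → α} (hg : Measurable g) :
    IsBoundedMeasurable fun x => f (g x) :=
  ⟨hf.measurable.comp hg, hf.exists_abs_le.imp fun _ hD x => hD (g x)⟩

theorem comp_apply {ι : Type*} {f : ℝ → ℝ} (hf : IsBoundedMeasurable f) (j : ι) :
    IsBoundedMeasurable fun x : ι → ℝ => f (x j) :=
  hf.comp (measurable_pi_apply j)

theorem integrable_mul [TopologicalSpace α] [OpensMeasurableSpace α] {μ : Measure α}
    [IsFiniteMeasureOnCompacts μ] (hf : IsBoundedMeasurable f) (hg : Continuous g)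
    (hgc : HasCompactSupport g) : Integrable (fun x => f x * g x) μ := by
  obtain ⟨C, hC⟩ := hf.exists_abs_le
  exact (hg.integrable_of_hasCompactSupport hgc).bdd_mul hf.measurable.aestronglyMeasurable
    (Filter.Eventually.of_forall hC)

end IsBoundedMeasurable

section QuadraticForm

variable {ι : Type*}

/-- The modulus `|∂_j Φ|`, the only way in which derivatives of `Φ` enter the energy. -/
noncomputable def partialNorm [DecidableEq ι] (Φ : (ι → ℝ) → ℂ) (j : ι) (x : ι → ℝ) : ℝ :=
  ‖fderiv ℝ Φ x (Pi.single j 1)‖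

/-- The energy density `M⁻¹ ∑_{j ∈ s} |∂_j Φ|² + P |Φ|²`, in which only the particles in `s`
carry kinetic energy. -/
noncomputable def formDensity [DecidableEq ι] (M : ℝ) (s : Finset ι) (P : (ι → ℝ) → ℝ)
    (Φ : (ι → ℝ) → ℂ) (x : ι → ℝ) : ℝ :=
  (1 / M) * ∑ j ∈ s, partialNorm Φ j x ^ 2 + P x * ‖Φ x‖ ^ 2

section Pointwise

variable [DecidableEq ι] {M : ℝ} {s : Finset ι} {P : (ι → ℝ) → ℝ} {Φ : (ι → ℝ) → ℂ}

theorem partialNorm_nonneg (Φ : (ι → ℝ) → ℂ) (j : ι) (x : ι → ℝ) : 0 ≤ partialNorm Φ j x :=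
  norm_nonneg _

theorem partialNorm_const_smul [Finite ι] (Φ : (ι → ℝ) → ℂ) (r : ℝ) (j : ι) (x : ι → ℝ) :
    partialNorm (fun x => r • Φ x) j x = |r| * partialNorm Φ j x := by
  have := Fintype.ofFinite ι
  have hderiv : fderiv ℝ (fun x => r • Φ x) = r • fderiv ℝ Φ := fderiv_const_smul_field r
  rw [partialNorm, partialNorm, hderiv, Pi.smul_apply, smul_apply, norm_smul, Real.norm_eq_abs]

theorem partialNorm_comp_smul [Finite ι] (Φ : (ι → ℝ) → ℂ) (r : ℝ) (j : ι) (x : ι → ℝ) :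
    partialNorm (fun x => Φ (r • x)) j x = |r| * partialNorm Φ j (r • x) := by
  have := Fintype.ofFinite ι
  rw [partialNorm, partialNorm, fderiv_comp_smul, smul_apply, norm_smul, Real.norm_eq_abs]

theorem partialNorm_smul_le [Finite ι] {x : ι → ℝ} (hΦ : DifferentiableAt ℝ Φ x)
    {f : (ι → ℝ) → ℝ} (hf : DifferentiableAt ℝ f x) (j : ι) :
    partialNorm (fun x => f x • Φ x) j x ≤
      |f x| * partialNorm Φ j x + |fderiv ℝ f x (Pi.single j 1)| * ‖Φ x‖ := by
  have := Fintype.ofFinite ι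
  rw [partialNorm, fderiv_fun_smul hf hΦ]
  exact (norm_add_le _ _).trans_eq (by simp [partialNorm])

theorem formDensity_const_smul [Finite ι] (M : ℝ) (s : Finset ι) (P : (ι → ℝ) → ℝ)
    (Φ : (ι → ℝ) → ℂ) (r : ℝ) (x : ι → ℝ) :
    formDensity M s P (fun x => r • Φ x) x = r ^ 2 * formDensity M s P Φ x := by
  simp only [formDensity, partialNorm_const_smul, mul_pow, sq_abs, norm_smul, Real.norm_eq_abs,
    ← Finset.mul_sum]
  ring

theorem mul_norm_sq_le_formDensity (hM : 0 ≤ M) {D : ℝ} (hD : ∀ x, D ≤ P x) (x : ι → ℝ) :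
    D * ‖Φ x‖ ^ 2 ≤ formDensity M s P Φ x := by
  have hkin : 0 ≤ 1 / M * ∑ j ∈ s, partialNorm Φ j x ^ 2 := by positivity
  exact (mul_le_mul_of_nonneg_right (hD x) (sq_nonneg _)).trans (le_add_of_nonneg_left hkin)

end Pointwise

variable [Fintype ι]

/-- Smooth compactly supported wave functions: the form core on which all energies are taken. -/
structure IsTestFunction (Φ : (ι → ℝ) → ℂ) : Prop where
  contDiff : ContDiff ℝ ∞ Φ
  hasCompactSupport : HasCompactSupport Φ

namespace IsTestFunction

variable {Φ : (ι → ℝ) → ℂ}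

theorem differentiable (hΦ : IsTestFunction Φ) : Differentiable ℝ Φ :=
  hΦ.contDiff.differentiable (by simp)

theorem continuous_fderiv (hΦ : IsTestFunction Φ) : Continuous (fderiv ℝ Φ) :=
  hΦ.contDiff.continuous_fderiv (by simp)

theorem hasCompactSupport_norm_sq (hΦ : IsTestFunction Φ) :
    HasCompactSupport fun x => ‖Φ x‖ ^ 2 :=
  hΦ.hasCompactSupport.comp_left (g := fun z : ℂ => ‖z‖ ^ 2) (by simp)

theorem integrable_mul_norm_sq (hΦ : IsTestFunction Φ) {f : (ι → ℝ) → ℝ}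
    (hf : IsBoundedMeasurable f) : Integrable fun x => f x * ‖Φ x‖ ^ 2 :=
  hf.integrable_mul (hΦ.contDiff.continuous.norm.pow 2) hΦ.hasCompactSupport_norm_sq

theorem integrable_norm_sq (hΦ : IsTestFunction Φ) : Integrable fun x => ‖Φ x‖ ^ 2 := by
  simpa using hΦ.integrable_mul_norm_sq (.const 1)

theorem smul (hΦ : IsTestFunction Φ) {f : (ι → ℝ) → ℝ} (hf : ContDiff ℝ ∞ f) :
    IsTestFunction fun x => f x • Φ x where
  contDiff := hf.smul hΦ.contDiff
  hasCompactSupport := HasCompactSupport.smul_left (f := f) hΦ.hasCompactSupport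

theorem comp_smul (hΦ : IsTestFunction Φ) {r : ℝ} (hr : r ≠ 0) :
    IsTestFunction fun x => Φ (r • x) :=
  ⟨hΦ.contDiff.comp (contDiff_const_smul r), hΦ.hasCompactSupport.comp_smul hr⟩

variable [DecidableEq ι]

theorem continuous_partialNorm (hΦ : IsTestFunction Φ) (j : ι) : Continuous (partialNorm Φ j) :=
  (hΦ.continuous_fderiv.clm_apply continuous_const).norm

theorem hasCompactSupport_partialNorm (hΦ : IsTestFunction Φ) (j : ι) :
    HasCompactSupport (partialNorm Φ j) :=
  (hΦ.hasCompactSupport.fderiv (𝕜 := ℝ)).comp_left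
    (g := fun L : (ι → ℝ) →L[ℝ] ℂ => ‖L (Pi.single j 1)‖) (by simp)

theorem integrable_mul_partialNorm_sq (hΦ : IsTestFunction Φ) (j : ι) {f : (ι → ℝ) → ℝ}
    (hf : IsBoundedMeasurable f) : Integrable fun x => f x * partialNorm Φ j x ^ 2 :=
  hf.integrable_mul ((hΦ.continuous_partialNorm j).pow 2)
    ((hΦ.hasCompactSupport_partialNorm j).comp_left (g := fun t : ℝ => t ^ 2) (by simp))

theorem integrable_partialNorm_sq (hΦ : IsTestFunction Φ) (j : ι) :
    Integrable fun x => partialNorm Φ j x ^ 2 := by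
  simpa using hΦ.integrable_mul_partialNorm_sq j (.const 1)

theorem integrable_norm_mul_partialNorm (hΦ : IsTestFunction Φ) (j : ι) :
    Integrable fun x => ‖Φ x‖ * partialNorm Φ j x :=
  (hΦ.contDiff.continuous.norm.mul (hΦ.continuous_partialNorm j)).integrable_of_hasCompactSupport
    (hΦ.hasCompactSupport_partialNorm j).mul_left

end IsTestFunction

theorem integral_norm_normalize_sq {Φ : (ι → ℝ) → ℂ} (hΦ : 0 < ∫ x, ‖Φ x‖ ^ 2) :
    ∫ x, ‖(√(∫ x, ‖Φ x‖ ^ 2))⁻¹ • Φ x‖ ^ 2 = 1 := by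
  simp only [norm_smul, mul_pow, norm_inv, Real.norm_eq_abs, inv_pow, sq_abs]
  rw [integral_const_mul, Real.sq_sqrt hΦ.le, inv_mul_cancel₀ hΦ.ne']

theorem isTestFunction_contDiffBump {c : ι → ℝ} (b : ContDiffBump c) :
    IsTestFunction fun x => (b x : ℂ) :=
  ⟨Complex.ofRealCLM.contDiff.comp b.contDiff,
    b.hasCompactSupport.comp_left (g := fun t : ℝ => (t : ℂ)) (by simp)⟩

theorem integral_norm_contDiffBump_sq_pos {c : ι → ℝ} (b : ContDiffBump c) :
    0 < ∫ x, ‖(b x : ℂ)‖ ^ 2 := by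
  refine (integral_pos_iff_support_of_nonneg (fun x => sq_nonneg _)
    (isTestFunction_contDiffBump b).integrable_norm_sq).2 ?_
  have hsupp : Function.support (fun x => ‖(b x : ℂ)‖ ^ 2) = Metric.ball c b.rOut := by
    rw [← b.support_eq]
    ext x
    simp
  rw [hsupp]
  exact Metric.measure_ball_pos _ _ b.rOut_pos

/-- The bottom of the spectrum of `-M⁻¹ Δ + P`, as an infimum over normalized test functions. -/
noncomputable def formInf [DecidableEq ι] (M : ℝ) (P : (ι → ℝ) → ℝ) : ℝ :=
  sInf {E : ℝ | ∃ Φ : (ι → ℝ) → ℂ, ContDiff ℝ ∞ Φ ∧ HasCompactSupport Φ ∧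
    ∫ x, ‖Φ x‖ ^ 2 = 1 ∧ E = ∫ x, formDensity M Finset.univ P Φ x}

variable [DecidableEq ι] {M : ℝ} {s : Finset ι} {P : (ι → ℝ) → ℝ} {Φ : (ι → ℝ) → ℂ}

theorem IsTestFunction.integrable_mul_formDensity (hΦ : IsTestFunction Φ) (M : ℝ) (s : Finset ι)
    (hP : IsBoundedMeasurable P) {f : (ι → ℝ) → ℝ} (hf : IsBoundedMeasurable f) :
    Integrable fun x => f x * formDensity M s P Φ x := by
  have hkin : Integrable fun x => 1 / M * ∑ j ∈ s, f x * partialNorm Φ j x ^ 2 :=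
    (integrable_finsetSum _ fun j _ => hΦ.integrable_mul_partialNorm_sq j hf).const_mul _
  refine (hkin.add (hΦ.integrable_mul_norm_sq (hf.mul hP))).congr (.of_forall fun x => ?_)
  simp only [formDensity, Pi.add_apply, ← Finset.mul_sum]
  ring

theorem IsTestFunction.integrable_formDensity (hΦ : IsTestFunction Φ) (M : ℝ) (s : Finset ι)
    (hP : IsBoundedMeasurable P) : Integrable (formDensity M s P Φ) := by
  simpa using hΦ.integrable_mul_formDensity M s hP (.const 1)

theorem IsTestFunction.mul_integral_norm_sq_le_integral_formDensity (hΦ : IsTestFunction Φ)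
    (hM : 0 ≤ M) (hP : IsBoundedMeasurable P) {D : ℝ} (hD : ∀ x, D ≤ P x) :
    D * ∫ x, ‖Φ x‖ ^ 2 ≤ ∫ x, formDensity M s P Φ x := by
  rw [← integral_const_mul]
  exact integral_mono (hΦ.integrable_norm_sq.const_mul D) (hΦ.integrable_formDensity M s hP)
    (mul_norm_sq_le_formDensity hM hD)

theorem formInf_le (hM : 0 ≤ M) (hP : IsBoundedMeasurable P) (hΦ : IsTestFunction Φ)
    (hnorm : ∫ x, ‖Φ x‖ ^ 2 = 1) : formInf M P ≤ ∫ x, formDensity M Finset.univ P Φ x := by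
  obtain ⟨D, hD⟩ := hP.exists_abs_le
  refine csInf_le ⟨-D, ?_⟩ ⟨Φ, hΦ.contDiff, hΦ.hasCompactSupport, hnorm, rfl⟩
  rintro E ⟨Ψ, hΨ, hΨc, hΨ1, rfl⟩
  simpa [hΨ1] using (IsTestFunction.mk hΨ hΨc).mul_integral_norm_sq_le_integral_formDensity
    (s := Finset.univ) hM hP fun x => (abs_le.1 (hD x)).1

theorem formInf_mul_le (hM : 0 ≤ M) (hP : IsBoundedMeasurable P) (hΦ : IsTestFunction Φ) :
    formInf M P * ∫ x, ‖Φ x‖ ^ 2 ≤ ∫ x, formDensity M Finset.univ P Φ x := by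
  have hnonneg : 0 ≤ ∫ x, ‖Φ x‖ ^ 2 := integral_nonneg fun x => sq_nonneg _
  rcases hnonneg.eq_or_lt with hnull | hpos
  · obtain ⟨D, hD⟩ := hP.exists_abs_le
    simpa [← hnull] using hΦ.mul_integral_norm_sq_le_integral_formDensity (s := Finset.univ) hM hP
      fun x => (abs_le.1 (hD x)).1
  · have hle := formInf_le hM hP (hΦ.smul contDiff_const) (integral_norm_normalize_sq hpos)
    simp only [formDensity_const_smul, inv_pow, integral_const_mul, Real.sq_sqrt hpos.le] at hle
    rwa [← div_eq_inv_mul, le_div_iff₀ hpos] at hle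

theorem exists_integral_formDensity_lt (M : ℝ) (P : (ι → ℝ) → ℝ) {δ : ℝ} (hδ : 0 < δ) :
    ∃ Φ : (ι → ℝ) → ℂ, IsTestFunction Φ ∧ ∫ x, ‖Φ x‖ ^ 2 = 1 ∧
      ∫ x, formDensity M Finset.univ P Φ x < formInf M P + δ := by
  let b : ContDiffBump (0 : ι → ℝ) := ⟨1 / 2, 1, by norm_num, by norm_num⟩
  have ht := (isTestFunction_contDiffBump b).smul
    (f := fun _ => (√(∫ x, ‖(b x : ℂ)‖ ^ 2))⁻¹) contDiff_const
  have hne : {E : ℝ | ∃ Φ : (ι → ℝ) → ℂ, ContDiff ℝ ∞ Φ ∧ HasCompactSupport Φ ∧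
      ∫ x, ‖Φ x‖ ^ 2 = 1 ∧ E = ∫ x, formDensity M Finset.univ P Φ x}.Nonempty :=
    ⟨_, _, ht.contDiff, ht.hasCompactSupport,
      integral_norm_normalize_sq (integral_norm_contDiffBump_sq_pos b), rfl⟩
  obtain ⟨_, ⟨Ψ, hΨ, hΨc, hnorm, rfl⟩, hlt⟩ :=
    exists_lt_of_csInf_lt hne (lt_add_of_pos_right (formInf M P) hδ)
  exact ⟨Ψ, ⟨hΨ, hΨc⟩, hnorm, hlt⟩

end QuadraticForm

section Localization

variable {ι : Type*} {G : (ι → ℝ) → ℝ} {s : ℝ} {x : ι → ℝ}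

theorem norm_sqrt_smul_sq {a : ℝ} (ha : 0 ≤ a) (z : ℂ) : ‖√a • z‖ ^ 2 = a * ‖z‖ ^ 2 := by
  rw [norm_smul, mul_pow, Real.norm_eq_abs, sq_abs, Real.sq_sqrt ha]

theorem abs_fderiv_sqrt_one_sub_mul_mul {E : Type*} [NormedAddCommGroup E] [NormedSpace ℝ E]
    {G : E → ℝ} {x : E} (hG : DifferentiableAt ℝ G x) (hs : 0 ≤ s) (hpos : 0 < 1 - s * G x)
    (v : E) :
    |fderiv ℝ (fun x => √(1 - s * G x)) x v| * (2 * √(1 - s * G x)) = s * |fderiv ℝ G x v| := by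
  have hsqrt := Real.sqrt_pos.2 hpos
  rw [((hG.hasFDerivAt.const_mul s).const_sub 1).sqrt hpos.ne' |>.fderiv]
  simp only [smul_apply, neg_apply, smul_eq_mul, abs_mul, abs_neg, abs_of_nonneg hs,
    abs_of_pos (one_div_pos.2 (mul_pos two_pos hsqrt))]
  field_simp

variable [DecidableEq ι] {M : ℝ} {Φ : (ι → ℝ) → ℂ}

theorem partialNorm_sqrt_smul_sq_le [Finite ι] (hΦ : DifferentiableAt ℝ Φ x)
    (hG : DifferentiableAt ℝ G x) {j : ι} (hG' : |fderiv ℝ G x (Pi.single j 1)| ≤ 1) (hs : 0 ≤ s)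
    (hsG : s * G x ≤ 1 / 2) :
    partialNorm (fun x => √(1 - s * G x) • Φ x) j x ^ 2 ≤
      (1 - s * G x) * partialNorm Φ j x ^ 2 + s * (‖Φ x‖ * partialNorm Φ j x) +
        s ^ 2 / 2 * ‖Φ x‖ ^ 2 := by
  have := Fintype.ofFinite ι
  have hpos : 0 < 1 - s * G x := by linarith
  have hf : DifferentiableAt ℝ (fun x => √(1 - s * G x)) x :=
    ((hG.const_mul s).const_sub 1).sqrt hpos.ne'
  have hsmul := partialNorm_smul_le hΦ hf j
  rw [abs_of_nonneg (Real.sqrt_nonneg _)] at hsmul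
  have hcross := abs_fderiv_sqrt_one_sub_mul_mul hG hs hpos (Pi.single j 1)
  set d := |fderiv ℝ (fun x => √(1 - s * G x)) x (Pi.single j 1)|
  have hd : d * (2 * √(1 - s * G x)) ≤ s := hcross.trans_le (mul_le_of_le_one_right hs hG')
  have hd2 : d ^ 2 ≤ s ^ 2 / 2 := by
    have hsq := pow_le_pow_left₀ (by positivity) hd 2
    rw [mul_pow, mul_pow, Real.sq_sqrt hpos.le] at hsq
    nlinarith [sq_nonneg d]
  calc _ ≤ (√(1 - s * G x) * partialNorm Φ j x + d * ‖Φ x‖) ^ 2 :=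
        pow_le_pow_left₀ (norm_nonneg _) hsmul 2
    _ = √(1 - s * G x) ^ 2 * partialNorm Φ j x ^ 2 +
          d * (2 * √(1 - s * G x)) * (‖Φ x‖ * partialNorm Φ j x) + d ^ 2 * ‖Φ x‖ ^ 2 := by ring
    _ ≤ _ := by
      rw [Real.sq_sqrt hpos.le]
      have hnonneg := mul_nonneg (norm_nonneg (Φ x)) (partialNorm_nonneg Φ j x)
      gcongr

theorem formDensity_sqrt_smul_le [Finite ι] (hM : 0 ≤ M) (t : Finset ι) (P : (ι → ℝ) → ℝ)
    (hΦ : DifferentiableAt ℝ Φ x) (hG : DifferentiableAt ℝ G x)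
    (hG' : ∀ j, |fderiv ℝ G x (Pi.single j 1)| ≤ 1) (hs : 0 ≤ s) (hsG : s * G x ≤ 1 / 2) :
    formDensity M t P (fun x => √(1 - s * G x) • Φ x) x ≤
      formDensity M t P Φ x - s * (G x * formDensity M t P Φ x) +
        s / M * ∑ j ∈ t, ‖Φ x‖ * partialNorm Φ j x + t.card * s ^ 2 / (2 * M) * ‖Φ x‖ ^ 2 := by
  have hkin := mul_le_mul_of_nonneg_left (Finset.sum_le_sum fun j (_ : j ∈ t) =>
    partialNorm_sqrt_smul_sq_le hΦ hG (hG' j) hs hsG) (one_div_nonneg.2 hM)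
  rw [Finset.sum_add_distrib, Finset.sum_add_distrib, ← Finset.mul_sum, ← Finset.mul_sum,
    Finset.sum_const, nsmul_eq_mul] at hkin
  rw [formDensity, norm_sqrt_smul_sq (by linarith)]
  refine (add_le_add_left hkin _).trans_eq ?_
  rw [formDensity]
  ring

variable [Fintype ι] {P : (ι → ℝ) → ℝ}

theorem IsTestFunction.integral_formDensity_sqrt_smul_le (hΦ : IsTestFunction Φ) (hM : 0 ≤ M)
    (hP : IsBoundedMeasurable P) (hG : ContDiff ℝ ∞ G) (hGb : IsBoundedMeasurable G)
    (hG' : ∀ x j, |fderiv ℝ G x (Pi.single j 1)| ≤ 1) (hs : 0 ≤ s)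
    (hsG : ∀ x, s * G x ≤ 1 / 2) :
    ∫ x, formDensity M Finset.univ P (fun x => √(1 - s * G x) • Φ x) x ≤
      (∫ x, formDensity M Finset.univ P Φ x) -
        s * (∫ x, G x * formDensity M Finset.univ P Φ x) +
        s / M * ∑ j, (∫ x, ‖Φ x‖ * partialNorm Φ j x) +
        Fintype.card ι * s ^ 2 / (2 * M) * ∫ x, ‖Φ x‖ ^ 2 := by
  have hf : ContDiff ℝ ∞ fun x => √(1 - s * G x) :=
    (contDiff_const.sub (contDiff_const.mul hG)).sqrt fun x => by linarith [hsG x]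
  have hE := hΦ.integrable_formDensity M Finset.univ hP
  have hGE := (hΦ.integrable_mul_formDensity M Finset.univ hP hGb).const_mul s
  have hcross : ∀ j ∈ Finset.univ, Integrable fun x => ‖Φ x‖ * partialNorm Φ j x :=
    fun j _ => hΦ.integrable_norm_mul_partialNorm j
  have hcross_sum := (integrable_finsetSum Finset.univ hcross).const_mul (s / M)
  have hnorm := hΦ.integrable_norm_sq.const_mul (Fintype.card ι * s ^ 2 / (2 * M))
  have hbound := integral_mono ((hΦ.smul hf).integrable_formDensity M Finset.univ hP)
    (((hE.sub hGE).add hcross_sum).add hnorm) fun x =>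
      formDensity_sqrt_smul_le hM Finset.univ P (hΦ.differentiable x)
        (hG.differentiable (by simp) x) (hG' x) hs (hsG x)
  refine hbound.trans_eq ?_
  rw [integral_add' ((hE.sub hGE).add hcross_sum) hnorm, integral_add' (hE.sub hGE) hcross_sum,
    integral_sub' hE hGE, integral_const_mul, integral_const_mul, integral_const_mul,
    integral_finsetSum _ hcross]

/-- The competitor `√(1 - s G) Φ` keeps the multiplier `G` outside the derivatives. -/
theorem IsTestFunction.integral_mul_formDensity_sub_le (hΦ : IsTestFunction Φ)
    (hnorm : ∫ x, ‖Φ x‖ ^ 2 = 1) (hM : 0 ≤ M) (hP : IsBoundedMeasurable P) {δ : ℝ}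
    (hδ : ∫ x, formDensity M Finset.univ P Φ x ≤ formInf M P + δ) (hG : ContDiff ℝ ∞ G)
    (hGb : IsBoundedMeasurable G) (hG' : ∀ x j, |fderiv ℝ G x (Pi.single j 1)| ≤ 1) (hs : 0 < s)
    (hsG : ∀ x, s * G x ≤ 1 / 2) :
    (∫ x, G x * formDensity M Finset.univ P Φ x) - formInf M P * ∫ x, G x * ‖Φ x‖ ^ 2 ≤
      δ / s + 1 / M * ∑ j, (∫ x, ‖Φ x‖ * partialNorm Φ j x) + Fintype.card ι * s / (2 * M) := by
  have hf : ContDiff ℝ ∞ fun x => √(1 - s * G x) :=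
    (contDiff_const.sub (contDiff_const.mul hG)).sqrt fun x => by linarith [hsG x]
  have hupper := hΦ.integral_formDensity_sqrt_smul_le hM hP hG hGb hG' hs.le hsG
  have hlower := formInf_mul_le hM hP (hΦ.smul hf)
  have hmass : ∫ x, ‖√(1 - s * G x) • Φ x‖ ^ 2 =
      (∫ x, ‖Φ x‖ ^ 2) - s * ∫ x, G x * ‖Φ x‖ ^ 2 := by
    rw [← integral_const_mul, ← integral_sub hΦ.integrable_norm_sq
      ((hΦ.integrable_mul_norm_sq hGb).const_mul s)]
    refine integral_congr_ae (.of_forall fun x => ?_)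
    dsimp only
    rw [norm_sqrt_smul_sq (by linarith [hsG x])]
    ring
  rw [hmass, hnorm] at hlower
  rw [hnorm] at hupper
  refine le_of_mul_le_mul_left ?_ hs
  calc _ ≤ δ + s / M * ∑ j, (∫ x, ‖Φ x‖ * partialNorm Φ j x) +
        Fintype.card ι * s ^ 2 / (2 * M) := by linarith
    _ = _ := by field_simp

end Localization

section Slicing

variable {ι : Type*} {p : ι → Prop} [DecidablePred p]

/-- The configuration of all particles assembled from that of the particles satisfying `p` and
that of the others. -/
def glue (u : {j // p j} → ℝ) (y : {j // ¬ p j} → ℝ) (j : ι) : ℝ :=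
  if h : p j then u ⟨j, h⟩ else y ⟨j, h⟩

theorem glue_apply_pos (u : {j // p j} → ℝ) (y : {j // ¬ p j} → ℝ) (j : {j // p j}) :
    glue u y j = u j :=
  dif_pos j.2

theorem glue_apply_neg (u : {j // p j} → ℝ) (y : {j // ¬ p j} → ℝ) (j : {j // ¬ p j}) :
    glue u y j = y j :=
  dif_neg j.2

theorem glue_add_smul_single [DecidableEq ι] [DecidableEq {j // p j}] (u : {j // p j} → ℝ)
    (y : {j // ¬ p j} → ℝ) (j : {j // p j}) (t : ℝ) :
    glue (u + t • Pi.single j 1) y = glue u y + t • Pi.single (j : ι) 1 := by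
  funext k
  by_cases hk : p k
  · simp [glue, hk, Pi.single_apply, Subtype.ext_iff]
  · simp [glue, hk, show k ≠ j from fun h => hk (h ▸ j.2)]

theorem isClosedEmbedding_glue (y : {j // ¬ p j} → ℝ) :
    Topology.IsClosedEmbedding fun u : {j // p j} → ℝ => glue u y := by
  have hleft : Function.LeftInverse (fun (x : ι → ℝ) (j : {j // p j}) => x j)
      (fun u => glue u y) := fun u => funext fun j => glue_apply_pos u y j
  refine hleft.isClosedEmbedding (by fun_prop) (continuous_pi fun j => ?_)
  by_cases hj : p j <;> simp only [glue, hj, dite_true, dite_false] <;> fun_prop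

variable [Fintype ι]

theorem contDiff_glue (y : {j // ¬ p j} → ℝ) :
    ContDiff ℝ ∞ fun u : {j // p j} → ℝ => glue u y := by
  refine contDiff_pi.2 fun j => ?_
  unfold glue
  split_ifs with h
  · exact contDiff_apply ℝ ℝ _
  · exact contDiff_const

theorem IsTestFunction.slice {Φ : (ι → ℝ) → ℂ} (hΦ : IsTestFunction Φ) (y : {j // ¬ p j} → ℝ) :
    IsTestFunction fun u : {j // p j} → ℝ => Φ (glue u y) :=
  ⟨hΦ.contDiff.comp (contDiff_glue y),
    hΦ.hasCompactSupport.comp_isClosedEmbedding (isClosedEmbedding_glue y)⟩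

theorem integral_eq_integral_glue {F : (ι → ℝ) → ℝ} (hF : Integrable F) :
    ∫ x, F x = ∫ y : {j // ¬ p j} → ℝ, ∫ u : {j // p j} → ℝ, F (glue u y) := by
  have hmp := (volume_preserving_piEquivPiSubtypeProd (fun _ : ι => ℝ) p).symm
  rw [← hmp.integral_comp' F]
  exact integral_prod_symm _ (hmp.integrable_comp_of_integrable hF)

variable [DecidableEq ι] [DecidableEq {j // p j}] {Φ : (ι → ℝ) → ℂ} {M : ℝ}

theorem IsTestFunction.partialNorm_slice (hΦ : IsTestFunction Φ) (u : {j // p j} → ℝ)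
    (y : {j // ¬ p j} → ℝ) (j : {j // p j}) :
    partialNorm (fun u => Φ (glue u y)) j u = partialNorm Φ (j : ι) (glue u y) := by
  unfold partialNorm
  rw [← (hΦ.differentiable _).lineDeriv_eq_fderiv,
    ← ((hΦ.slice y).differentiable _).lineDeriv_eq_fderiv]
  simp only [lineDeriv, glue_add_smul_single]

theorem IsTestFunction.formDensity_slice (hΦ : IsTestFunction Φ) (P : ({j // p j} → ℝ) → ℝ)
    (u : {j // p j} → ℝ) (y : {j // ¬ p j} → ℝ) :
    formDensity M Finset.univ P (fun u => Φ (glue u y)) u =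
      formDensity M (Finset.univ.filter p) (fun x => P fun j => x j) Φ (glue u y) := by
  have hsum : ∑ j ∈ Finset.univ.filter p, partialNorm Φ j (glue u y) ^ 2 =
      ∑ j : {j // p j}, partialNorm Φ (j : ι) (glue u y) ^ 2 :=
    Finset.sum_subtype _ (by simp) _
  simp only [formDensity, hΦ.partialNorm_slice, glue_apply_pos, hsum]

theorem IsTestFunction.formInf_subsystem_mul_le (hΦ : IsTestFunction Φ) (hM : 0 ≤ M)
    {P : ({j // p j} → ℝ) → ℝ} (hP : IsBoundedMeasurable P) {g : ({j // ¬ p j} → ℝ) → ℝ}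
    (hg : IsBoundedMeasurable g) (hg₀ : ∀ y, 0 ≤ g y) :
    formInf M P * ∫ x, g (fun j => x j) * ‖Φ x‖ ^ 2 ≤
      ∫ x, g (fun j => x j) *
        formDensity M (Finset.univ.filter p) (fun x => P fun j => x j) Φ x := by
  have hgx : IsBoundedMeasurable fun x : ι → ℝ => g fun j => x j := hg.comp (by fun_prop)
  have hPx : IsBoundedMeasurable fun x : ι → ℝ => P fun j => x j := hP.comp (by fun_prop)
  have hmass := (hΦ.integrable_mul_norm_sq hgx).const_mul (formInf M P)
  have hform := hΦ.integrable_mul_formDensity M (Finset.univ.filter p) hPx hgx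
  rw [← integral_const_mul, ← sub_nonneg, ← integral_sub' hform hmass,
    integral_eq_integral_glue (p := p) (hform.sub hmass)]
  refine integral_nonneg fun y => ?_
  have hslice := hΦ.slice (p := p) y
  have hfactor : ∀ u, g (fun j => glue u y j) *
      formDensity M (Finset.univ.filter p) (fun x => P fun j => x j) Φ (glue u y) -
        formInf M P * (g (fun j => glue u y j) * ‖Φ (glue u y)‖ ^ 2) =
      g y * (formDensity M Finset.univ P (fun u => Φ (glue u y)) u -
        formInf M P * ‖Φ (glue u y)‖ ^ 2) := fun u => by
    simp only [glue_apply_neg, hΦ.formDensity_slice]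
    ring
  simp only [Pi.sub_apply, Pi.zero_apply, hfactor, integral_const_mul]
  rw [integral_sub (hslice.integrable_formDensity M _ hP)
    (hslice.integrable_norm_sq.const_mul _), integral_const_mul]
  exact mul_nonneg (hg₀ y) (sub_nonneg.2 (formInf_mul_le hM hP hslice))

end Slicing

section IntegrationByParts

variable {ι : Type*} [Fintype ι] [DecidableEq ι] {Φ : (ι → ℝ) → ℂ} {j : ι}

theorem IsTestFunction.abs_fderiv_norm_sq_single_le (hΦ : IsTestFunction Φ) (j : ι) (x : ι → ℝ) :
    |fderiv ℝ (fun x => ‖Φ x‖ ^ 2) x (Pi.single j 1)| ≤ 2 * (‖Φ x‖ * partialNorm Φ j x) := by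
  rw [(hΦ.differentiable x).hasFDerivAt.norm_sq.fderiv]
  simp only [smul_apply, ContinuousLinearMap.comp_apply, innerSL_apply_apply, nsmul_eq_mul, abs_mul]
  exact (mul_le_mul_of_nonneg_left (abs_real_inner_le_norm _ _) (abs_nonneg _)).trans_eq
    (by simp [partialNorm])

theorem IsTestFunction.integral_fderiv_mul_norm_sq_le (hΦ : IsTestFunction Φ) {f : (ι → ℝ) → ℝ}
    (hf : Differentiable ℝ f) {b : ℝ} (hb : ∀ x, |f x| ≤ b)
    (hf' : IsBoundedMeasurable fun x => fderiv ℝ f x (Pi.single j 1)) :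
    ∫ x, fderiv ℝ f x (Pi.single j 1) * ‖Φ x‖ ^ 2 ≤
      2 * b * ∫ x, ‖Φ x‖ * partialNorm Φ j x := by
  have hfb : IsBoundedMeasurable f := ⟨hf.continuous.measurable, b, hb⟩
  have hsq : ContDiff ℝ ∞ fun x => ‖Φ x‖ ^ 2 := hΦ.contDiff.norm_sq ℝ
  have hparts_integrable : Integrable fun x =>
      f x * fderiv ℝ (fun x => ‖Φ x‖ ^ 2) x (Pi.single j 1) :=
    hfb.integrable_mul ((hsq.continuous_fderiv (by simp)).clm_apply continuous_const)
      ((hΦ.hasCompactSupport_norm_sq.fderiv (𝕜 := ℝ)).comp_left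
        (g := fun L : (ι → ℝ) →L[ℝ] ℝ => L (Pi.single j 1)) (by simp))
  have hparts := integral_mul_fderiv_eq_neg_fderiv_mul_of_integrable (hΦ.integrable_mul_norm_sq hf')
    hparts_integrable (hΦ.integrable_mul_norm_sq hfb) (fun x _ => hf x)
    fun x _ => hsq.differentiable (by simp) x
  rw [← neg_eq_iff_eq_neg.2 hparts, ← integral_neg, ← integral_const_mul]
  refine integral_mono hparts_integrable.neg ((hΦ.integrable_norm_mul_partialNorm j).const_mul _)
    fun x => (neg_le_abs _).trans ?_
  rw [abs_mul]
  calc _ ≤ b * (2 * (‖Φ x‖ * partialNorm Φ j x)) :=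
        mul_le_mul (hb x) (hΦ.abs_fderiv_norm_sq_single_le j x) (abs_nonneg _)
          ((abs_nonneg _).trans (hb x))
    _ = _ := by ring

theorem IsTestFunction.integral_deriv_apply_mul_norm_sq_le (hΦ : IsTestFunction Φ)
    {h h' : ℝ → ℝ} (hh : ∀ t, HasDerivAt h (h' t) t) {b : ℝ} (hb : ∀ t, |h t| ≤ b)
    (hh' : IsBoundedMeasurable h') (j : ι) :
    ∫ x, h' (x j) * ‖Φ x‖ ^ 2 ≤ 2 * b * ∫ x, ‖Φ x‖ * partialNorm Φ j x := by
  have hderiv : ∀ x : ι → ℝ, HasFDerivAt (fun x => h (x j))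
      (h' (x j) • ContinuousLinearMap.proj (R := ℝ) (φ := fun _ : ι => ℝ) j) x := fun x =>
    (hh (x j)).comp_hasFDerivAt x (ContinuousLinearMap.proj (φ := fun _ : ι => ℝ) j).hasFDerivAt
  have happly : ∀ x : ι → ℝ, fderiv ℝ (fun x : ι → ℝ => h (x j)) x (Pi.single j 1) = h' (x j) :=
    fun x => by simp [(hderiv x).fderiv]
  simpa only [happly] using hΦ.integral_fderiv_mul_norm_sq_le (j := j)
    (fun x => (hderiv x).differentiableAt) (fun x => hb (x j))
    (by simpa only [happly] using hh'.comp_apply j)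

theorem IsTestFunction.mul_integral_norm_mul_partialNorm_le (hΦ : IsTestFunction Φ) {M : ℝ}
    (hM : 0 < M) (c : ℝ) (j : ι) :
    c * ∫ x, ‖Φ x‖ * partialNorm Φ j x ≤
      1 / (2 * M) * (∫ x, partialNorm Φ j x ^ 2) + c ^ 2 * M / 2 * ∫ x, ‖Φ x‖ ^ 2 := by
  have hkin := (hΦ.integrable_partialNorm_sq j).const_mul (1 / (2 * M))
  have hmass := hΦ.integrable_norm_sq.const_mul (c ^ 2 * M / 2)
  rw [← integral_const_mul, ← integral_const_mul, ← integral_const_mul, ← integral_add hkin hmass]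
  refine integral_mono ((hΦ.integrable_norm_mul_partialNorm j).const_mul c) (hkin.add hmass)
    fun x => sub_nonneg.1 ?_
  have hsquare : 1 / (2 * M) * partialNorm Φ j x ^ 2 + c ^ 2 * M / 2 * ‖Φ x‖ ^ 2 -
      c * (‖Φ x‖ * partialNorm Φ j x) =
        1 / (2 * M) * (partialNorm Φ j x - c * M * ‖Φ x‖) ^ 2 := by
    field_simp
    ring
  exact hsquare ▸ (by positivity)

end IntegrationByParts

section LogarithmicFormBound

/-- The primitive `arsinh` of `(1 + x²)^{-1/2}`, cut off smoothly where it exceeds `S`, that is,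
where `(1 + x²)^{-1/2}` is exponentially small in `S`. -/
noncomputable def truncatedArsinh (S x : ℝ) : ℝ := S * Real.arctan (Real.arsinh x / S)

variable {S : ℝ}

theorem hasDerivAt_truncatedArsinh (hS : S ≠ 0) (x : ℝ) :
    HasDerivAt (truncatedArsinh S)
      ((√(1 + x ^ 2))⁻¹ * (1 / (1 + (Real.arsinh x / S) ^ 2))) x := by
  refine ((((Real.hasDerivAt_arsinh x).div_const S).arctan).const_mul S).congr_deriv ?_
  field_simp

theorem deriv_truncatedArsinh (hS : S ≠ 0) (x : ℝ) :
    deriv (truncatedArsinh S) x = (√(1 + x ^ 2))⁻¹ * (1 / (1 + (Real.arsinh x / S) ^ 2)) :=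
  (hasDerivAt_truncatedArsinh hS x).deriv

theorem abs_truncatedArsinh_le (hS : 0 < S) (x : ℝ) : |truncatedArsinh S x| ≤ 2 * S := by
  rw [truncatedArsinh, abs_mul, abs_of_pos hS, mul_comm]
  refine mul_le_mul_of_nonneg_right (abs_le.2 ⟨?_, ?_⟩) hS.le
  · linarith [Real.neg_pi_div_two_lt_arctan (Real.arsinh x / S), Real.pi_lt_four]
  · linarith [Real.arctan_lt_pi_div_two (Real.arsinh x / S), Real.pi_lt_four]

theorem isBoundedMeasurable_deriv_truncatedArsinh (hS : S ≠ 0) :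
    IsBoundedMeasurable (deriv (truncatedArsinh S)) := by
  refine .of_nonneg_of_le (D := 1) (measurable_deriv _) (fun x => ?_) fun x => ?_
  · rw [deriv_truncatedArsinh hS]
    positivity
  · rw [deriv_truncatedArsinh hS]
    refine mul_le_one₀ (inv_le_one_of_one_le₀ (Real.one_le_sqrt.2 ?_)) (by positivity)
      ((div_le_one (by positivity)).2 ?_)
    · exact le_add_of_nonneg_right (sq_nonneg x)
    · exact le_add_of_nonneg_right (sq_nonneg _)

theorem inv_sqrt_one_add_sq_le_of_le_abs_arsinh {x : ℝ} (hx : S ≤ |Real.arsinh x|) :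
    (√(1 + x ^ 2))⁻¹ ≤ 2 * Real.exp (-S) := by
  have hcosh : Real.exp S / 2 ≤ √(1 + x ^ 2) := by
    rw [← Real.cosh_arsinh, ← Real.cosh_abs, Real.cosh_eq]
    linarith [Real.exp_le_exp.2 hx, Real.exp_pos (-|Real.arsinh x|)]
  calc (√(1 + x ^ 2))⁻¹ ≤ (Real.exp S / 2)⁻¹ := inv_anti₀ (by positivity) hcosh
    _ = 2 * Real.exp (-S) := by rw [Real.exp_neg, inv_div, div_eq_mul_inv]

theorem inv_sqrt_one_add_sq_le (hS : 0 < S) (x : ℝ) :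
    (√(1 + x ^ 2))⁻¹ ≤ 2 * deriv (truncatedArsinh S) x + 2 * Real.exp (-S) := by
  rw [deriv_truncatedArsinh hS.ne']
  rcases le_total |Real.arsinh x| S with hx | hx
  · have hsq : (Real.arsinh x / S) ^ 2 ≤ 1 := by
      rw [sq_le_one_iff_abs_le_one, abs_div, abs_of_pos hS]
      exact (div_le_one hS).2 hx
    have hhalf : (1 : ℝ) / 2 ≤ 1 / (1 + (Real.arsinh x / S) ^ 2) :=
      one_div_le_one_div_of_le (by positivity) (by linarith)
    have hmul := mul_le_mul_of_nonneg_left hhalf (by positivity : 0 ≤ (√(1 + x ^ 2))⁻¹)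
    linarith [Real.exp_pos (-S)]
  · have hcut : 0 ≤ (√(1 + x ^ 2))⁻¹ * (1 / (1 + (Real.arsinh x / S) ^ 2)) := by positivity
    linarith [inv_sqrt_one_add_sq_le_of_le_abs_arsinh hx]

theorem isBoundedMeasurable_inv_sqrt_one_add_sq :
    IsBoundedMeasurable fun t : ℝ => (√(1 + t ^ 2))⁻¹ :=
  .of_nonneg_of_le (D := 1) (by fun_prop) (fun t => by positivity) fun t =>
    inv_le_one_of_one_le₀ (Real.one_le_sqrt.2 (le_add_of_nonneg_right (sq_nonneg t)))

variable {ι : Type*} [Fintype ι] [DecidableEq ι] {Φ : (ι → ℝ) → ℂ}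

theorem IsTestFunction.integral_inv_sqrt_one_add_sq_mul_norm_sq_le (hΦ : IsTestFunction Φ)
    (hS : 0 < S) (j : ι) :
    ∫ x, (√(1 + x j ^ 2))⁻¹ * ‖Φ x‖ ^ 2 ≤
      8 * S * (∫ x, ‖Φ x‖ * partialNorm Φ j x) + 2 * Real.exp (-S) * ∫ x, ‖Φ x‖ ^ 2 := by
  have hderiv := isBoundedMeasurable_deriv_truncatedArsinh hS.ne'
  have hparts := hΦ.integral_deriv_apply_mul_norm_sq_le
    (fun t => (hasDerivAt_truncatedArsinh hS.ne' t).differentiableAt.hasDerivAt)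
    (abs_truncatedArsinh_le hS) hderiv j
  have hcut := (hΦ.integrable_mul_norm_sq (hderiv.comp_apply j)).const_mul 2
  have hmass := hΦ.integrable_norm_sq.const_mul (2 * Real.exp (-S))
  have hmono := integral_mono
    (hΦ.integrable_mul_norm_sq (isBoundedMeasurable_inv_sqrt_one_add_sq.comp_apply j))
    (hcut.add hmass) fun x =>
      (mul_le_mul_of_nonneg_right (inv_sqrt_one_add_sq_le hS (x j)) (sq_nonneg ‖Φ x‖)).trans_eq
        (by simp only [Pi.add_apply]; ring)
  rw [integral_add' hcut hmass, integral_const_mul, integral_const_mul] at hmono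
  linarith

theorem IsTestFunction.kinetic_sub_le_integral_formDensity (hΦ : IsTestFunction Φ) {M c : ℝ}
    (hM : 0 < M) (hS : 0 < S) (hc : 0 ≤ c) {P : (ι → ℝ) → ℝ} (hP : IsBoundedMeasurable P)
    (hPc : ∀ x, -(c * ∑ j, (√(1 + x j ^ 2))⁻¹) ≤ P x) :
    1 / (2 * M) * ∑ j, (∫ x, partialNorm Φ j x ^ 2) -
        Fintype.card ι * ((8 * c * S) ^ 2 * M / 2 + 2 * c * Real.exp (-S)) * ∫ x, ‖Φ x‖ ^ 2 ≤
      ∫ x, formDensity M Finset.univ P Φ x := by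
  have hkin := fun j => (hΦ.integrable_partialNorm_sq j).const_mul (1 / M)
  have hpot := fun j => (hΦ.integrable_mul_norm_sq
    (isBoundedMeasurable_inv_sqrt_one_add_sq.comp_apply j)).const_mul c
  have hdiff := fun j => (hkin j).sub (hpot j)
  have hmono : ∑ j, (1 / M * (∫ x, partialNorm Φ j x ^ 2) -
      c * ∫ x, (√(1 + x j ^ 2))⁻¹ * ‖Φ x‖ ^ 2) ≤ ∫ x, formDensity M Finset.univ P Φ x := by
    simp only [← integral_const_mul, ← integral_sub' (hkin _) (hpot _)]
    rw [← integral_finsetSum _ fun j _ => hdiff j]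
    refine integral_mono (integrable_finsetSum _ fun j _ => hdiff j)
      (hΦ.integrable_formDensity M _ hP) fun x => ?_
    rw [formDensity]
    refine le_trans (le_of_eq ?_)
      (add_le_add_right (mul_le_mul_of_nonneg_right (hPc x) (sq_nonneg ‖Φ x‖)) _)
    rw [neg_mul, Finset.mul_sum, Finset.mul_sum, Finset.sum_mul, ← sub_eq_add_neg,
      ← Finset.sum_sub_distrib]
    exact Finset.sum_congr rfl fun j _ => by rw [Pi.sub_apply]; ring
  refine le_trans ?_ hmono
  rw [Finset.mul_sum, mul_assoc, ← nsmul_eq_mul, ← Finset.card_univ, ← Finset.sum_const,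
    ← Finset.sum_sub_distrib]
  refine Finset.sum_le_sum fun j _ => ?_
  have hlog := mul_le_mul_of_nonneg_left
    (hΦ.integral_inv_sqrt_one_add_sq_mul_norm_sq_le hS j) hc
  have hyoung := hΦ.mul_integral_norm_mul_partialNorm_le hM (8 * c * S) j
  have hsplit : 1 / M = 1 / (2 * M) + 1 / (2 * M) := by field_simp; norm_num
  rw [hsplit]
  linarith

end LogarithmicFormBound

section Dilation

variable {ι : Type*} [Fintype ι] [DecidableEq ι] {Φ : (ι → ℝ) → ℂ} {M c r : ℝ}
  {P : (ι → ℝ) → ℝ}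

theorem exists_isTestFunction_one_le_abs_sub (ι : Type*) [Fintype ι] :
    ∃ Φ : (ι → ℝ) → ℂ, IsTestFunction Φ ∧ (0 < ∫ x, ‖Φ x‖ ^ 2) ∧
      ∀ x, Φ x ≠ 0 → Pairwise fun j k => 1 ≤ |x j - x k| := by
  let c : ι → ℝ := fun i => 3 * ((Fintype.equivFin ι i : ℤ) : ℝ)
  let b : ContDiffBump c := ⟨1 / 2, 1, by norm_num, by norm_num⟩
  refine ⟨_, isTestFunction_contDiffBump b, integral_norm_contDiffBump_sq_pos b,
    fun x hx j k hjk => ?_⟩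
  have hball : x ∈ Metric.ball c 1 := by
    rw [← b.support_eq]
    simpa using hx
  have hclose : ∀ i, |x i - c i| < 1 := fun i =>
    (dist_le_pi_dist x c i).trans_lt (Metric.mem_ball.1 hball)
  have hcenters : 3 ≤ |c j - c k| := by
    have hne : ((Fintype.equivFin ι j : ℤ) - (Fintype.equivFin ι k : ℤ)) ≠ 0 := by
      simpa [sub_eq_zero, Fin.val_inj] using hjk
    have hint :
        (1 : ℝ) ≤ |((Fintype.equivFin ι j : ℤ) : ℝ) - ((Fintype.equivFin ι k : ℤ) : ℝ)| := by
      exact_mod_cast Int.one_le_abs hne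
    rw [← mul_sub, abs_mul, abs_of_pos three_pos]
    linarith
  have htri : |c j - c k| ≤ |x j - c j| + |x k - c k| + |x j - x k| := by
    rw [show c j - c k = (x j - x k) - ((x j - c j) - (x k - c k)) by ring]
    linarith [abs_sub (x j - x k) ((x j - c j) - (x k - c k)), abs_sub (x j - c j) (x k - c k)]
  linarith [hclose j, hclose k]

theorem formDensity_comp_smul_le (hM : 0 ≤ M) (hr : 0 ≤ r) (hr₁ : r ≤ 1) {x : ι → ℝ}
    (hP : Φ (r • x) ≠ 0 → P x ≤ c * r) :
    formDensity M Finset.univ P (fun x => Φ (r • x)) x ≤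
      r * formDensity M Finset.univ (fun _ => c) Φ (r • x) := by
  have hpot : P x * ‖Φ (r • x)‖ ^ 2 ≤ r * (c * ‖Φ (r • x)‖ ^ 2) := by
    rcases eq_or_ne (Φ (r • x)) 0 with hzero | hzero
    · simp [hzero]
    · exact (mul_le_mul_of_nonneg_right (hP hzero) (sq_nonneg _)).trans_eq (by ring)
  have hkin : 1 / M * ∑ j, (|r| * partialNorm Φ j (r • x)) ^ 2 ≤
      r * (1 / M * ∑ j, partialNorm Φ j (r • x) ^ 2) := by
    simp only [mul_pow, ← Finset.mul_sum, sq_abs]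
    rw [mul_left_comm]
    exact mul_le_mul_of_nonneg_right (by nlinarith) (by positivity)
  simp only [formDensity, partialNorm_comp_smul, mul_add]
  exact add_le_add hkin hpot

theorem formInf_nonpos_of_dilation (hM : 0 ≤ M) (hP : IsBoundedMeasurable P)
    (hΦ : IsTestFunction Φ) (hpos : 0 < ∫ x, ‖Φ x‖ ^ 2)
    (hPc : ∀ r > 0, ∀ x, Φ (r • x) ≠ 0 → P x ≤ c * r) : formInf M P ≤ 0 := by
  have hscaled : ∀ r ∈ Set.Ioc (0 : ℝ) 1, formInf M P * ∫ x, ‖Φ x‖ ^ 2 ≤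
      r * ∫ x, formDensity M Finset.univ (fun _ => c) Φ x := by
    rintro r ⟨hr, hr₁⟩
    have ht := hΦ.comp_smul hr.ne'
    have hc := hΦ.integrable_formDensity M Finset.univ (.const c)
    have hle := (formInf_mul_le hM hP ht).trans <|
      integral_mono (ht.integrable_formDensity M _ hP) ((hc.comp_smul hr.ne').const_mul r)
        fun x => formDensity_comp_smul_le hM hr.le hr₁ (hPc r hr x)
    rw [integral_const_mul, Measure.integral_comp_smul volume (fun x => ‖Φ x‖ ^ 2),
      Measure.integral_comp_smul, smul_eq_mul, smul_eq_mul, mul_left_comm, mul_left_comm r] at hle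
    exact le_of_mul_le_mul_left hle (abs_pos.2 (inv_ne_zero (pow_ne_zero _ hr.ne')))
  have hlim : Filter.Tendsto (fun r : ℝ => r * ∫ x, formDensity M Finset.univ (fun _ => c) Φ x)
      (nhdsWithin 0 (Set.Ioi 0)) (nhds 0) := by
    simpa using (tendsto_nhdsWithin_of_tendsto_nhds (s := Set.Ioi 0)
      (Filter.tendsto_id (α := ℝ) (x := nhds 0))).mul_const _
  have hle : formInf M P * ∫ x, ‖Φ x‖ ^ 2 ≤ 0 :=
    ge_of_tendsto hlim (Filter.eventually_of_mem (Ioc_mem_nhdsGT one_pos) hscaled)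
  exact nonpos_of_mul_nonpos_left hle hpos

end Dilation

section CoulombPotentials

variable {ι : Type} [Fintype ι] [LinearOrder ι] {V : ι → ℝ → ℝ} {W : ι → ι → ℝ → ℝ}
  {Z M : ℝ}

/-- Effective potentials of `n` particles that are Coulombic at distances beyond `√n`, the radius
of a Landau droplet of `n` particles. The upper bound on `W` is not smeared over that radius; it
serves only to show that widely separated particles do not interact. -/
structure HasCoulombBounds (V : ι → ℝ → ℝ) (W : ι → ι → ℝ → ℝ) : Prop where
  isBoundedMeasurable_V : ∀ j, IsBoundedMeasurable (V j)
  isBoundedMeasurable_W : ∀ j k, j < k → IsBoundedMeasurable (W j k)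
  V_nonneg : ∀ j x, 0 ≤ V j x
  V_le : ∀ j x, V j x ≤ 4 * (√(x ^ 2 + Fintype.card ι))⁻¹
  le_W : ∀ j k x, j < k → (√(x ^ 2 + 4 * Fintype.card ι))⁻¹ ≤ W j k x
  W_le : ∀ j k x, j < k → x ≠ 0 → W j k x ≤ |x|⁻¹

/-- The potential that remains when particle `i` is removed. -/
noncomputable def omitPotential (Z : ℝ) (V : ι → ℝ → ℝ) (W : ι → ι → ℝ → ℝ) (i : ι) :
    ({j // j ≠ i} → ℝ) → ℝ :=
  potential Z (fun j => V j) fun j k => W j k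

theorem groundEnergy_eq_formInf (Z M : ℝ) (V : ι → ℝ → ℝ) (W : ι → ι → ℝ → ℝ) :
    groundEnergy Z M V W = formInf M (potential Z V W) :=
  rfl

theorem groundEnergy_omit_eq_formInf (Z M : ℝ) (V : ι → ℝ → ℝ) (W : ι → ι → ℝ → ℝ) (i : ι) :
    groundEnergy (ι := {j // j ≠ i}) Z M (fun j => V j) (fun j k => W j k) =
      formInf M (omitPotential Z V W i) :=
  rfl

theorem isBoundedMeasurable_potential (Z : ℝ) (hV : ∀ j, IsBoundedMeasurable (V j))
    (hW : ∀ j k, j < k → IsBoundedMeasurable (W j k)) :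
    IsBoundedMeasurable (potential Z V W) := by
  refine ((IsBoundedMeasurable.const (-Z)).mul (.sum _ fun j => (hV j).comp_apply j)).add
    (.sum _ fun j => .sum _ fun k => ?_)
  by_cases hjk : j < k
  · simpa only [if_pos hjk] using (hW j k hjk).comp (by fun_prop)
  · simpa only [if_neg hjk] using IsBoundedMeasurable.const 0

namespace HasCoulombBounds

theorem W_nonneg (h : HasCoulombBounds V W) {j k : ι} (hjk : j < k) (x : ℝ) : 0 ≤ W j k x :=
  le_trans (by positivity) (h.le_W j k x hjk)

theorem isBoundedMeasurable_potential (h : HasCoulombBounds V W) (Z : ℝ) :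
    IsBoundedMeasurable (potential Z V W) :=
  SlaterModel.isBoundedMeasurable_potential Z h.isBoundedMeasurable_V h.isBoundedMeasurable_W

theorem isBoundedMeasurable_omitPotential (h : HasCoulombBounds V W) (Z : ℝ) (i : ι) :
    IsBoundedMeasurable (omitPotential Z V W i) :=
  SlaterModel.isBoundedMeasurable_potential Z (fun j => h.isBoundedMeasurable_V j)
    fun j k => h.isBoundedMeasurable_W j k

theorem V_le_inv_sqrt_one_add_sq (h : HasCoulombBounds V W) (j : ι) (x : ℝ) :
    V j x ≤ 4 * (√(1 + x ^ 2))⁻¹ := by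
  have hcard : (1 : ℝ) ≤ Fintype.card ι := by exact_mod_cast Fintype.card_pos_iff.2 ⟨j⟩
  refine (h.V_le j x).trans (mul_le_mul_of_nonneg_left (inv_anti₀ ?_ ?_) (by norm_num))
  · exact Real.sqrt_pos.2 (by positivity)
  · exact Real.sqrt_le_sqrt (by linarith)

theorem neg_sum_le_potential (h : HasCoulombBounds V W) (hZ : 0 ≤ Z) (x : ι → ℝ) :
    -(4 * Z * ∑ j, (√(1 + x j ^ 2))⁻¹) ≤ potential Z V W x := by
  have hattraction : Z * ∑ j, V j (x j) ≤ Z * (4 * ∑ j, (√(1 + x j ^ 2))⁻¹) := by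
    rw [Finset.mul_sum Finset.univ _ 4]
    exact mul_le_mul_of_nonneg_left
      (Finset.sum_le_sum fun j _ => h.V_le_inv_sqrt_one_add_sq j (x j)) hZ
  have hrepulsion : 0 ≤ ∑ j, ∑ k, if j < k then W j k (x j - x k) else 0 :=
    Finset.sum_nonneg fun j _ => Finset.sum_nonneg fun k _ => by
      split_ifs with hjk
      exacts [h.W_nonneg hjk _, le_rfl]
  rw [potential]
  linarith

theorem potential_le_of_one_le_abs_sub (h : HasCoulombBounds V W) (hZ : 0 ≤ Z) {r : ℝ}
    (hr : 0 < r) {x : ι → ℝ} (hx : Pairwise fun j k => 1 ≤ |(r • x) j - (r • x) k|) :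
    potential Z V W x ≤ Fintype.card ι ^ 2 * r := by
  have hattraction : 0 ≤ Z * ∑ j, V j (x j) :=
    mul_nonneg hZ (Finset.sum_nonneg fun j _ => h.V_nonneg j _)
  have hpair : ∀ j k, (if j < k then W j k (x j - x k) else 0) ≤ r := fun j k => by
    split_ifs with hjk
    · have hsep : r⁻¹ ≤ |x j - x k| := by
        have hdil : 1 ≤ |(r • x) j - (r • x) k| := hx hjk.ne
        rw [Pi.smul_apply, Pi.smul_apply, ← smul_sub, smul_eq_mul, abs_mul, abs_of_pos hr] at hdil
        exact (inv_le_iff_one_le_mul₀' hr).2 hdil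
      have hne : x j - x k ≠ 0 := abs_pos.1 ((inv_pos.2 hr).trans_le hsep)
      exact (h.W_le j k _ hjk hne).trans (inv_le_of_inv_le₀ hr hsep)
    · exact hr.le
  have hrepulsion := Finset.sum_le_sum (s := Finset.univ) fun j _ =>
    Finset.sum_le_sum (s := Finset.univ) fun k _ => hpair j k
  simp only [Finset.sum_const, Finset.card_univ, nsmul_eq_mul] at hrepulsion
  rw [potential]
  linarith

/-- Particles spread out over large mutual distances have arbitrarily small energy. -/
theorem formInf_potential_nonpos (h : HasCoulombBounds V W) (hZ : 0 ≤ Z) (hM : 0 ≤ M) :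
    formInf M (potential Z V W) ≤ 0 := by
  obtain ⟨Φ, hΦ, hpos, hsep⟩ := exists_isTestFunction_one_le_abs_sub ι
  exact formInf_nonpos_of_dilation hM (h.isBoundedMeasurable_potential Z) hΦ hpos
    fun r hr x hx => h.potential_le_of_one_le_abs_sub hZ hr (hsep _ hx)

end HasCoulombBounds

end CoulombPotentials

section Weight

/-- A bounded version of the distance `√(t² + n)`, the multiplier of the Lieb argument. -/
noncomputable def weight (n l t : ℝ) : ℝ := √(t ^ 2 + n) / (1 + l * √(t ^ 2 + n))

variable {n l : ℝ}

theorem weight_nonneg (hl : 0 < l) (t : ℝ) : 0 ≤ weight n l t := by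
  unfold weight
  positivity

theorem weight_le_sqrt (hl : 0 < l) (t : ℝ) : weight n l t ≤ √(t ^ 2 + n) :=
  div_le_self (Real.sqrt_nonneg _) (le_add_of_nonneg_right (by positivity))

theorem weight_le_inv (hl : 0 < l) (t : ℝ) : weight n l t ≤ l⁻¹ := by
  rw [weight, div_le_iff₀ (by positivity), mul_add, inv_mul_cancel_left₀ hl.ne']
  exact le_add_of_nonneg_left (by positivity)

theorem contDiff_weight (hn : 0 < n) (hl : 0 < l) : ContDiff ℝ ∞ (weight n l) := by
  have hsqrt : ContDiff ℝ ∞ fun t : ℝ => √(t ^ 2 + n) :=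
    ((contDiff_id.pow 2).add contDiff_const).sqrt fun t => by positivity
  exact hsqrt.div (contDiff_const.add (contDiff_const.mul hsqrt)) fun t => by positivity

theorem isBoundedMeasurable_weight (hn : 0 < n) (hl : 0 < l) : IsBoundedMeasurable (weight n l) :=
  .of_nonneg_of_le (contDiff_weight hn hl).continuous.measurable (weight_nonneg hl)
    (weight_le_inv hl)

theorem hasDerivAt_weight (hn : 0 < n) (hl : 0 < l) (t : ℝ) :
    HasDerivAt (weight n l) (t / √(t ^ 2 + n) / (1 + l * √(t ^ 2 + n)) ^ 2) t := by
  have hpos : 0 < t ^ 2 + n := by positivity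
  have hsqrt : HasDerivAt (fun t : ℝ => √(t ^ 2 + n)) (t / √(t ^ 2 + n)) t := by
    refine (((hasDerivAt_pow 2 t).add_const n).sqrt hpos.ne').congr_deriv ?_
    field_simp
    simp
  refine (hsqrt.div ((hsqrt.const_mul l).const_add 1) (by positivity)).congr_deriv ?_
  field_simp
  ring

theorem abs_deriv_weight_le_one (hn : 0 < n) (hl : 0 < l) (t : ℝ) :
    |deriv (weight n l) t| ≤ 1 := by
  have hsqrt : 0 < √(t ^ 2 + n) := Real.sqrt_pos.2 (by positivity)
  rw [(hasDerivAt_weight hn hl t).deriv, abs_div, abs_div, abs_of_pos hsqrt,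
    abs_of_pos (by positivity : 0 < (1 + l * √(t ^ 2 + n)) ^ 2)]
  refine div_le_one_of_le₀ ?_ (by positivity)
  calc |t| / √(t ^ 2 + n) ≤ 1 := div_le_one_of_le₀ (Real.abs_le_sqrt (by linarith)) hsqrt.le
    _ ≤ (1 + l * √(t ^ 2 + n)) ^ 2 := one_le_pow₀ (by linarith [mul_pos hl hsqrt])

theorem two_thirds_sqrt_le_weight {K t : ℝ} (hl : 0 < l) (hlK : l * K ≤ 1 / 2)
    (ht : √(t ^ 2 + n) ≤ K) : 2 / 3 * √(t ^ 2 + n) ≤ weight n l t := by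
  have hsmall : l * √(t ^ 2 + n) ≤ 1 / 2 := (mul_le_mul_of_nonneg_left ht hl.le).trans hlK
  rw [weight, le_div_iff₀ (by positivity)]
  nlinarith [Real.sqrt_nonneg (t ^ 2 + n)]

theorem two_thirds_mul_le_weight {K t : ℝ} (hl : 0 < l) (hlK : l * K ≤ 1 / 2)
    (ht : K ≤ √(t ^ 2 + n)) : 2 / 3 * K ≤ weight n l t := by
  rw [weight, le_div_iff₀ (by positivity)]
  nlinarith [Real.sqrt_nonneg (t ^ 2 + n)]

theorem sqrt_sub_sq_add_le (hn : 0 ≤ n) (t u : ℝ) :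
    √((t - u) ^ 2 + 4 * n) ≤ √(t ^ 2 + n) + √(u ^ 2 + n) := by
  have hcross : n - t * u ≤ √(t ^ 2 + n) * √(u ^ 2 + n) := by
    rw [← Real.sqrt_mul (by positivity)]
    exact Real.le_sqrt_of_sq_le (by nlinarith [mul_nonneg hn (sq_nonneg (t + u))])
  refine Real.sqrt_le_iff.2 ⟨by positivity, ?_⟩
  rw [add_sq, Real.sq_sqrt (by positivity), Real.sq_sqrt (by positivity)]
  linarith

variable {ι : Type*} [Fintype ι]

theorem contDiff_sum_weight (hn : 0 < n) (hl : 0 < l) :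
    ContDiff ℝ ∞ fun x : ι → ℝ => ∑ i, weight n l (x i) :=
  ContDiff.sum fun i _ => (contDiff_weight hn hl).comp (contDiff_apply ℝ ℝ i)

theorem isBoundedMeasurable_sum_weight (hn : 0 < n) (hl : 0 < l) :
    IsBoundedMeasurable fun x : ι → ℝ => ∑ i, weight n l (x i) :=
  .sum _ fun i => (isBoundedMeasurable_weight hn hl).comp_apply i

theorem sum_weight_le (hl : 0 < l) (x : ι → ℝ) :
    ∑ i, weight n l (x i) ≤ Fintype.card ι * l⁻¹ :=
  (Finset.sum_le_card_nsmul _ _ _ fun i _ => weight_le_inv hl (x i)).trans_eq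
    (by rw [Finset.card_univ, nsmul_eq_mul])

theorem abs_fderiv_sum_weight_le_one [DecidableEq ι] (hn : 0 < n) (hl : 0 < l) (x : ι → ℝ)
    (j : ι) : |fderiv ℝ (fun x : ι → ℝ => ∑ i, weight n l (x i)) x (Pi.single j 1)| ≤ 1 := by
  have hderiv : HasFDerivAt (fun x : ι → ℝ => ∑ i, weight n l (x i))
      (∑ i, deriv (weight n l) (x i) •
        ContinuousLinearMap.proj (R := ℝ) (φ := fun _ : ι => ℝ) i) x :=
    HasFDerivAt.fun_sum fun i _ =>
      HasDerivAt.comp_hasFDerivAt (h₂ := weight n l) (f := fun x : ι → ℝ => x i) x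
        (hasDerivAt_weight hn hl (x i)).differentiableAt.hasDerivAt
        (ContinuousLinearMap.proj (R := ℝ) (φ := fun _ : ι => ℝ) i).hasFDerivAt
  have happly : fderiv ℝ (fun x : ι → ℝ => ∑ i, weight n l (x i)) x (Pi.single j 1) =
      deriv (weight n l) (x j) := by
    simp [hderiv.fderiv, Pi.single_apply]
  exact happly ▸ abs_deriv_weight_le_one hn hl (x j)

end Weight

section LiebArgument

variable {ι : Type} [Fintype ι] [LinearOrder ι] {V : ι → ℝ → ℝ} {W : ι → ι → ℝ → ℝ}
  {Z M κ l S : ℝ} {Φ : (ι → ℝ) → ℂ}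

theorem potential_sub_omitPotential (Z : ℝ) (V : ι → ℝ → ℝ) (W : ι → ι → ℝ → ℝ) (i : ι)
    (x : ι → ℝ) :
    potential Z V W x - omitPotential Z V W i (fun j => x j) =
      -Z * V i (x i) + (∑ k, if i < k then W i k (x i - x k) else 0) +
        ∑ j, if j < i then W j i (x j - x i) else 0 := by
  set a : ι → ι → ℝ := fun j k => if j < k then W j k (x j - x k) else 0 with ha
  have hcolumn : ∑ j, a j i = ∑ j : {j // j ≠ i}, a j i := by
    rw [Fintype.sum_eq_add_sum_subtype_ne _ i]
    simp [ha]
  have hpairs : ∑ j, ∑ k, a j k =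
      ∑ k, a i k + (∑ j, a j i + ∑ j : {j // j ≠ i}, ∑ k : {k // k ≠ i}, a j k) := by
    rw [Fintype.sum_eq_add_sum_subtype_ne _ i, hcolumn, ← Finset.sum_add_distrib]
    exact congrArg _ (Finset.sum_congr rfl fun j _ => Fintype.sum_eq_add_sum_subtype_ne _ i)
  have homit : omitPotential Z V W i (fun j => x j) =
      -Z * ∑ j : {j // j ≠ i}, V j (x j) + ∑ j : {j // j ≠ i}, ∑ k : {k // k ≠ i}, a j k :=
    rfl
  have hfull : potential Z V W x = -Z * ∑ j, V j (x j) + ∑ j, ∑ k, a j k := rfl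
  rw [homit, hfull, hpairs, Fintype.sum_eq_add_sum_subtype_ne (fun j => V j (x j)) i]
  ring

theorem sum_mul_potential_sub_omitPotential (Z : ℝ) (V : ι → ℝ → ℝ) (W : ι → ι → ℝ → ℝ)
    (w x : ι → ℝ) :
    ∑ i, w i * (potential Z V W x - omitPotential Z V W i fun j => x j) =
      -Z * ∑ i, w i * V i (x i) +
        ∑ j, ∑ k, if j < k then (w j + w k) * W j k (x j - x k) else 0 := by
  have hsplit : ∀ j k, (if j < k then (w j + w k) * W j k (x j - x k) else 0) =
      w j * (if j < k then W j k (x j - x k) else 0) +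
        w k * if j < k then W j k (x j - x k) else 0 := fun j k => by
    split_ifs <;> ring
  simp only [potential_sub_omitPotential, hsplit, mul_add, Finset.sum_add_distrib, Finset.mul_sum]
  rw [Finset.sum_comm (f := fun i j => w i * if j < i then W j i (x j - x i) else 0), add_assoc]
  simp only [mul_left_comm]

theorem sum_sum_ite_lt (c : ℝ) : ∑ j : ι, ∑ k : ι, (if j < k then c else 0) =
    Fintype.card ι * (Fintype.card ι - 1) / 2 * c := by
  have hsymm : ∑ j : ι, ∑ k : ι, (if j < k then c else 0) =
      ∑ j : ι, ∑ k : ι, (if k < j then c else 0) := Finset.sum_comm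
  have htrichotomy : ∀ j k : ι, (if j < k then c else 0) + (if k < j then c else 0) =
      c - if j = k then c else 0 := fun j k => by
    rcases lt_trichotomy j k with h | h | h
    · simp [h, h.ne, h.not_gt]
    · simp [h]
    · simp [h, h.ne', h.not_gt]
  have hboth : ∑ j : ι, ∑ k : ι, ((if j < k then c else 0) + (if k < j then c else 0)) =
      Fintype.card ι * (Fintype.card ι * c) - Fintype.card ι * c := by
    simp [htrichotomy]
  simp only [Finset.sum_add_distrib, ← hsymm] at hboth
  linarith

namespace HasCoulombBounds

theorem sum_weight_mul_V_le (h : HasCoulombBounds V W) (hl : 0 < l) (x : ι → ℝ) :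
    ∑ i, weight (Fintype.card ι) l (x i) * V i (x i) ≤ 4 * Fintype.card ι := by
  refine (Finset.sum_le_card_nsmul _ _ 4 fun i _ => ?_).trans_eq
    (by rw [Finset.card_univ, nsmul_eq_mul, mul_comm])
  have hcard : (0 : ℝ) < Fintype.card ι := by exact_mod_cast Fintype.card_pos_iff.2 ⟨i⟩
  have hsqrt : 0 < √(x i ^ 2 + Fintype.card ι) := Real.sqrt_pos.2 (by positivity)
  calc weight (Fintype.card ι) l (x i) * V i (x i)
      ≤ √(x i ^ 2 + Fintype.card ι) * (4 * (√(x i ^ 2 + Fintype.card ι))⁻¹) :=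
        mul_le_mul (weight_le_sqrt hl _) (h.V_le i _) (h.V_nonneg i _) hsqrt.le
    _ = 4 := by field_simp

theorem two_thirds_le_weight_add_mul_W (h : HasCoulombBounds V W) (hl : 0 < l) {K : ℝ}
    (hlK : l * K ≤ 1 / 2) {j k : ι} (hjk : j < k) {t u : ℝ}
    (ht : √(t ^ 2 + Fintype.card ι) ≤ K) (hu : √(u ^ 2 + Fintype.card ι) ≤ K) :
    2 / 3 ≤ (weight (Fintype.card ι) l t + weight (Fintype.card ι) l u) * W j k (t - u) := by
  have hcard : (0 : ℝ) < Fintype.card ι := by exact_mod_cast Fintype.card_pos_iff.2 ⟨j⟩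
  have hsqrt : 0 < √((t - u) ^ 2 + 4 * Fintype.card ι) := Real.sqrt_pos.2 (by positivity)
  have hweight : 2 / 3 * √((t - u) ^ 2 + 4 * Fintype.card ι) ≤
      weight (Fintype.card ι) l t + weight (Fintype.card ι) l u := by
    linarith [sqrt_sub_sq_add_le hcard.le t u, two_thirds_sqrt_le_weight hl hlK ht,
      two_thirds_sqrt_le_weight hl hlK hu]
  calc (2 / 3 : ℝ) = 2 / 3 * √((t - u) ^ 2 + 4 * Fintype.card ι) *
        (√((t - u) ^ 2 + 4 * Fintype.card ι))⁻¹ := (mul_inv_cancel_right₀ hsqrt.ne' _).symm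
    _ ≤ _ := mul_le_mul hweight (h.le_W j k _ hjk) (by positivity)
        (add_nonneg (weight_nonneg hl t) (weight_nonneg hl u))

/-- As long as all particles stay where the weight is comparable to the distance, each pair
contributes `2 / 3`; a single particle further out is paid for by its binding energy `κ`. -/
theorem card_mul_le_sum_weight_add_repulsion (h : HasCoulombBounds V W) [Nonempty ι]
    (hκ : 0 < κ) (hl : l = κ / (4 * Fintype.card ι ^ 2)) (x : ι → ℝ) :
    (Fintype.card ι * (Fintype.card ι - 1) / 3 : ℝ) ≤
      κ * (∑ i, weight (Fintype.card ι) l (x i)) + ∑ j, ∑ k, if j < k then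
        (weight (Fintype.card ι) l (x j) + weight (Fintype.card ι) l (x k)) *
          W j k (x j - x k) else 0 := by
  have hcard : (1 : ℝ) ≤ Fintype.card ι := by exact_mod_cast Fintype.card_pos
  have hl₀ : 0 < l := hl ▸ by positivity
  have hw := weight_nonneg (n := Fintype.card ι) hl₀
  set K : ℝ := 2 * Fintype.card ι ^ 2 / κ with hK
  have hlK : l * K = 1 / 2 := by
    rw [hl, hK]
    field_simp
    norm_num
  by_cases hx : ∃ i, K ≤ √(x i ^ 2 + Fintype.card ι)
  · obtain ⟨i, hi⟩ := hx
    have hfar : 2 / 3 * K ≤ ∑ i, weight (Fintype.card ι) l (x i) :=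
      (two_thirds_mul_le_weight hl₀ hlK.le hi).trans <|
        Finset.single_le_sum (f := fun i => weight (Fintype.card ι) l (x i))
          (fun i _ => hw (x i)) (Finset.mem_univ i)
    have hbinding := mul_le_mul_of_nonneg_left hfar hκ.le
    have hκK : κ * (2 / 3 * K) = 4 / 3 * Fintype.card ι ^ 2 := by
      rw [hK]
      field_simp
      norm_num
    refine le_add_of_le_of_nonneg (by nlinarith) <|
      Finset.sum_nonneg fun j _ => Finset.sum_nonneg fun k _ => ?_
    split_ifs with hjk
    exacts [mul_nonneg (add_nonneg (hw _) (hw _)) (h.W_nonneg hjk _), le_rfl]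
  · push Not at hx
    have hpairs : (Fintype.card ι * (Fintype.card ι - 1) / 3 : ℝ) =
        ∑ j : ι, ∑ k : ι, if j < k then (2 / 3 : ℝ) else 0 := by
      rw [sum_sum_ite_lt]
      ring
    rw [hpairs]
    refine le_add_of_nonneg_of_le (mul_nonneg hκ.le (Finset.sum_nonneg fun i _ => hw (x i))) <|
      Finset.sum_le_sum fun j _ => Finset.sum_le_sum fun k _ => ?_
    split_ifs with hjk
    exacts [h.two_thirds_le_weight_add_mul_W hl₀ hlK.le hjk (hx j).le (hx k).le, le_rfl]

theorem card_mul_le_sum_weight_mul_potential_sub (h : HasCoulombBounds V W) [Nonempty ι]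
    (hZ : 0 ≤ Z) (hκ : 0 < κ) (hl : l = κ / (4 * Fintype.card ι ^ 2)) (x : ι → ℝ) :
    (Fintype.card ι * (Fintype.card ι - 1) / 3 - 4 * Z * Fintype.card ι : ℝ) ≤
      ∑ i, weight (Fintype.card ι) l (x i) *
        (potential Z V W x - omitPotential Z V W i (fun j => x j) + κ) := by
  have hl₀ : 0 < l := hl ▸ by positivity
  have hattraction := mul_le_mul_of_nonneg_left (h.sum_weight_mul_V_le hl₀ x) hZ
  have hrepulsion := h.card_mul_le_sum_weight_add_repulsion hκ hl x
  simp only [mul_add _ _ κ, Finset.sum_add_distrib, sum_mul_potential_sub_omitPotential,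
    ← Finset.sum_mul]
  linarith

theorem isBoundedMeasurable_weight_mul_potential_sub (h : HasCoulombBounds V W) (Z κ : ℝ)
    (hl : 0 < l) (i : ι) :
    IsBoundedMeasurable fun x : ι → ℝ => weight (Fintype.card ι) l (x i) *
      (potential Z V W x - omitPotential Z V W i (fun j => x j) + κ) := by
  have hcard : (0 : ℝ) < Fintype.card ι := by exact_mod_cast Fintype.card_pos_iff.2 ⟨i⟩
  have homit : IsBoundedMeasurable fun x : ι → ℝ => omitPotential Z V W i fun j => x j :=
    (h.isBoundedMeasurable_omitPotential Z i).comp (by fun_prop)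
  have hsub := (h.isBoundedMeasurable_potential Z).add ((IsBoundedMeasurable.const (-1)).mul homit)
  simpa only [neg_one_mul, ← sub_eq_add_neg] using
    ((isBoundedMeasurable_weight hcard hl).comp_apply i).mul (hsub.add (.const κ))

theorem integral_weight_mul_potential_sub_le (h : HasCoulombBounds V W) (hM : 0 ≤ M)
    (hl : 0 < l) {i : ι}
    (hbind : formInf M (potential Z V W) + κ ≤ formInf M (omitPotential Z V W i))
    (hΦ : IsTestFunction Φ) :
    ∫ x, weight (Fintype.card ι) l (x i) *
        (potential Z V W x - omitPotential Z V W i (fun j => x j) + κ) * ‖Φ x‖ ^ 2 ≤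
      (∫ x, weight (Fintype.card ι) l (x i) * formDensity M Finset.univ (potential Z V W) Φ x) -
        formInf M (potential Z V W) * ∫ x, weight (Fintype.card ι) l (x i) * ‖Φ x‖ ^ 2 := by
  have hcard : (0 : ℝ) < Fintype.card ι := by exact_mod_cast Fintype.card_pos_iff.2 ⟨i⟩
  have hw := isBoundedMeasurable_weight hcard hl
  have hwi := hw.comp_apply i
  have hP := h.isBoundedMeasurable_potential Z
  have homit := h.isBoundedMeasurable_omitPotential Z i
  have homitx : IsBoundedMeasurable fun x : ι → ℝ => omitPotential Z V W i fun j => x j :=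
    homit.comp (by fun_prop)
  have hslice := hΦ.formInf_subsystem_mul_le (p := (· ≠ i)) hM homit
    (hw.comp_apply ⟨i, not_not.2 rfl⟩) fun y => weight_nonneg hl _
  have hmass := hΦ.integrable_mul_norm_sq hwi
  have hfull := hΦ.integrable_mul_formDensity M Finset.univ hP hwi
  have hsub := hΦ.integrable_mul_formDensity M (Finset.univ.filter (· ≠ i)) homitx hwi
  have hmass_nonneg : 0 ≤ ∫ x, weight (Fintype.card ι) l (x i) * ‖Φ x‖ ^ 2 :=
    integral_nonneg fun x => mul_nonneg (weight_nonneg hl (x i)) (sq_nonneg _)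
  have hbind_mass := mul_le_mul_of_nonneg_right hbind hmass_nonneg
  have hpointwise : ∀ x, weight (Fintype.card ι) l (x i) *
      (potential Z V W x - omitPotential Z V W i (fun j => x j) + κ) * ‖Φ x‖ ^ 2 ≤
      weight (Fintype.card ι) l (x i) * formDensity M Finset.univ (potential Z V W) Φ x -
        weight (Fintype.card ι) l (x i) * formDensity M (Finset.univ.filter (· ≠ i))
          (fun x => omitPotential Z V W i fun j => x j) Φ x +
        κ * (weight (Fintype.card ι) l (x i) * ‖Φ x‖ ^ 2) := fun x => by
    have hkin := mul_le_mul_of_nonneg_left (Finset.sum_le_sum_of_subset_of_nonneg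
      (Finset.filter_subset (· ≠ i) Finset.univ) fun j _ _ => sq_nonneg (partialNorm Φ j x))
      (mul_nonneg (weight_nonneg (n := Fintype.card ι) hl (x i)) (one_div_nonneg.2 hM))
    simp only [formDensity]
    linarith
  have hmono := integral_mono
    (hΦ.integrable_mul_norm_sq (h.isBoundedMeasurable_weight_mul_potential_sub Z κ hl i))
    ((hfull.sub hsub).add (hmass.const_mul κ)) hpointwise
  rw [integral_add' (hfull.sub hsub) (hmass.const_mul κ), integral_sub' hfull hsub,
    integral_const_mul] at hmono
  linarith

theorem card_mul_sub_le_integral_sum_weight_mul (h : HasCoulombBounds V W) [Nonempty ι]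
    (hZ : 0 ≤ Z) (hM : 0 ≤ M) (hκ : 0 < κ) (hl : l = κ / (4 * Fintype.card ι ^ 2))
    (hbind : ∀ i, formInf M (potential Z V W) + κ ≤ formInf M (omitPotential Z V W i))
    (hΦ : IsTestFunction Φ) (hnorm : ∫ x, ‖Φ x‖ ^ 2 = 1) :
    (Fintype.card ι * (Fintype.card ι - 1) / 3 - 4 * Z * Fintype.card ι : ℝ) ≤
      (∫ x, (∑ i, weight (Fintype.card ι) l (x i)) *
        formDensity M Finset.univ (potential Z V W) Φ x) -
      formInf M (potential Z V W) * ∫ x, (∑ i, weight (Fintype.card ι) l (x i)) * ‖Φ x‖ ^ 2 := by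
  have hcard : (0 : ℝ) < Fintype.card ι := by exact_mod_cast Fintype.card_pos
  have hl₀ : 0 < l := hl ▸ by positivity
  have hP := h.isBoundedMeasurable_potential Z
  have hwi := fun i : ι => (isBoundedMeasurable_weight hcard hl₀).comp_apply i
  have hmass := fun i => hΦ.integrable_mul_norm_sq (hwi i)
  have hfull := fun i => hΦ.integrable_mul_formDensity M Finset.univ hP (hwi i)
  simp only [Finset.sum_mul]
  rw [integral_finsetSum _ fun i _ => hmass i, integral_finsetSum _ fun i _ => hfull i,
    Finset.mul_sum, ← Finset.sum_sub_distrib]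
  refine le_trans ?_ (Finset.sum_le_sum fun i _ =>
    h.integral_weight_mul_potential_sub_le hM hl₀ (hbind i) hΦ)
  have hlower := fun i => hΦ.integrable_mul_norm_sq
    (h.isBoundedMeasurable_weight_mul_potential_sub Z κ hl₀ i)
  rw [← integral_finsetSum _ fun i _ => hlower i]
  calc (Fintype.card ι * (Fintype.card ι - 1) / 3 - 4 * Z * Fintype.card ι : ℝ)
      = ∫ x, (Fintype.card ι * (Fintype.card ι - 1) / 3 - 4 * Z * Fintype.card ι : ℝ) *
          ‖Φ x‖ ^ 2 := by rw [integral_const_mul, hnorm, mul_one]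
    _ ≤ _ := integral_mono ((integrable_of_integral_eq_one hnorm).const_mul _)
        (integrable_finsetSum _ fun i _ => hlower i) fun x => by
          simpa only [Finset.sum_mul] using mul_le_mul_of_nonneg_right
            (h.card_mul_le_sum_weight_mul_potential_sub hZ hκ hl x) (sq_nonneg ‖Φ x‖)

theorem inv_mul_sum_integral_norm_mul_partialNorm_le (h : HasCoulombBounds V W) (hZ : 1 ≤ Z)
    (hM : 0 < M) (hS : 1 ≤ S) (hSM : Real.exp (-S) ≤ M) (hΦ : IsTestFunction Φ)
    (hnorm : ∫ x, ‖Φ x‖ ^ 2 = 1) {δ : ℝ}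
    (hδ : ∫ x, formDensity M Finset.univ (potential Z V W) Φ x ≤ δ) :
    1 / M * ∑ j, (∫ x, ‖Φ x‖ * partialNorm Φ j x) ≤
      521 * Fintype.card ι * (Z * S) + δ / (M * (Z * S)) := by
  have hkin := hΦ.kinetic_sub_le_integral_formDensity hM (by positivity : 0 < S)
    (by positivity : 0 ≤ 4 * Z) (h.isBoundedMeasurable_potential Z)
    (h.neg_sum_le_potential (by positivity))
  have hyoung : Z * S * ∑ j, (∫ x, ‖Φ x‖ * partialNorm Φ j x) ≤
      1 / (2 * M) * ∑ j, (∫ x, partialNorm Φ j x ^ 2) +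
        Fintype.card ι * ((Z * S) ^ 2 * M / 2) := by
    rw [Finset.mul_sum, Finset.mul_sum, ← nsmul_eq_mul, ← Finset.card_univ, ← Finset.sum_const,
      ← Finset.sum_add_distrib]
    exact Finset.sum_le_sum fun j _ => by
      simpa [hnorm] using hΦ.mul_integral_norm_mul_partialNorm_le hM (Z * S) j
  have htail : Z * Real.exp (-S) ≤ (Z * S) ^ 2 * M := by
    have hle : Z ≤ Z * S := le_mul_of_one_le_right (by positivity) hS
    exact mul_le_mul (hle.trans (le_self_pow₀ (hZ.trans hle) two_ne_zero)) hSM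
      (Real.exp_pos _).le (by positivity)
  have htail_card := mul_le_mul_of_nonneg_left htail (Nat.cast_nonneg (α := ℝ) (Fintype.card ι))
  rw [hnorm] at hkin
  have hscaled : Z * S * ∑ j, (∫ x, ‖Φ x‖ * partialNorm Φ j x) ≤
      521 * Fintype.card ι * ((Z * S) ^ 2 * M) + δ := by
    have : 0 ≤ Fintype.card ι * ((Z * S) ^ 2 * M) := by positivity
    linarith
  calc 1 / M * ∑ j, (∫ x, ‖Φ x‖ * partialNorm Φ j x)
      = (Z * S * ∑ j, (∫ x, ‖Φ x‖ * partialNorm Φ j x)) / (M * (Z * S)) := by field_simp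
    _ ≤ (521 * Fintype.card ι * ((Z * S) ^ 2 * M) + δ) / (M * (Z * S)) := by gcongr
    _ = 521 * Fintype.card ι * (Z * S) + δ / (M * (Z * S)) := by field_simp

theorem card_mul_sub_le_of_bound (h : HasCoulombBounds V W) [Nonempty ι] (hZ : 1 ≤ Z)
    (hM : 0 < M) (hS : 1 ≤ S) (hSM : Real.exp (-S) ≤ M) (hκ : 0 < κ)
    (hbind : ∀ i, formInf M (potential Z V W) + κ ≤ formInf M (omitPotential Z V W i)) :
    (Fintype.card ι * (Fintype.card ι - 1) / 3 - 4 * Z * Fintype.card ι : ℝ) ≤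
      521 * Fintype.card ι * (Z * S) + 3 := by
  have hcard : (0 : ℝ) < Fintype.card ι := by exact_mod_cast Fintype.card_pos
  obtain ⟨l, hl⟩ : ∃ l, l = κ / (4 * (Fintype.card ι : ℝ) ^ 2) := ⟨_, rfl⟩
  have hl₀ : 0 < l := hl ▸ by positivity
  obtain ⟨s, hs₀, hsl, hsM⟩ : ∃ s, 0 < s ∧ s * (Fintype.card ι * l⁻¹) ≤ 1 / 2 ∧
      Fintype.card ι * s / (2 * M) ≤ 1 := by
    refine ⟨min (1 / 2 / (Fintype.card ι * l⁻¹)) (2 * M / Fintype.card ι), by positivity, ?_, ?_⟩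
    · exact (le_div_iff₀ (by positivity)).1 (min_le_left _ _)
    · rw [div_le_one (by positivity), mul_comm]
      exact (le_div_iff₀ hcard).1 (min_le_right _ _)
  obtain ⟨δ, hδ₀, hδs, hδM⟩ : ∃ δ, 0 < δ ∧ δ ≤ s ∧ δ ≤ M * (Z * S) :=
    ⟨min s (M * (Z * S)), by positivity, min_le_left _ _, min_le_right _ _⟩
  obtain ⟨Φ, hΦ, hnorm, hmin⟩ := exists_integral_formDensity_lt M (potential Z V W) hδ₀
  have hnonpos := h.formInf_potential_nonpos (Z := Z) (M := M) (by positivity) hM.le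
  have hlower := h.card_mul_sub_le_integral_sum_weight_mul (by positivity) hM.le hκ hl hbind hΦ
    hnorm
  have hupper := hΦ.integral_mul_formDensity_sub_le hnorm hM.le (h.isBoundedMeasurable_potential Z)
    hmin.le (contDiff_sum_weight hcard hl₀) (isBoundedMeasurable_sum_weight hcard hl₀)
    (abs_fderiv_sum_weight_le_one hcard hl₀) hs₀ fun x =>
      (mul_le_mul_of_nonneg_left (sum_weight_le hl₀ x) hs₀.le).trans hsl
  have hgradient := h.inv_mul_sum_integral_norm_mul_partialNorm_le hZ hM hS hSM hΦ hnorm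
    (hmin.le.trans (by linarith : formInf M (potential Z V W) + δ ≤ δ))
  have hδs' : δ / s ≤ 1 := (div_le_one hs₀).2 hδs
  have hδM' : δ / (M * (Z * S)) ≤ 1 := (div_le_one (by positivity)).2 hδM
  linarith

theorem card_le_of_bound (h : HasCoulombBounds V W) (hZ : 1 ≤ Z) (hM : 0 < M) (hS : 1 ≤ S)
    (hSM : Real.exp (-S) ≤ M)
    (hbind : ∀ i, formInf M (potential Z V W) < formInf M (omitPotential Z V W i)) :
    (Fintype.card ι : ℝ) ≤ 1600 * Z * S := by
  have hZS : 1 ≤ Z * S := one_le_mul_of_one_le_of_one_le hZ hS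
  rcases isEmpty_or_nonempty ι with hι | hι
  · rw [Fintype.card_eq_zero, Nat.cast_zero]
    positivity
  obtain ⟨i₀, hi₀⟩ := Finite.exists_min fun i => formInf M (omitPotential Z V W i)
  have hbound := h.card_mul_sub_le_of_bound hZ hM hS hSM (sub_pos.2 (hbind i₀))
    fun i => by linarith [hi₀ i]
  have hcard : (1 : ℝ) ≤ Fintype.card ι := by exact_mod_cast Fintype.card_pos
  have hZ_le : Fintype.card ι * Z ≤ Fintype.card ι * (Z * S) :=
    mul_le_mul_of_nonneg_left (le_mul_of_one_le_right (by positivity) hS) (by positivity)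
  have hone_le : 1 ≤ Fintype.card ι * (Z * S) := one_le_mul_of_one_le_of_one_le hcard hZS
  have hquadratic : Fintype.card ι * (Fintype.card ι - 1 : ℝ) ≤
      Fintype.card ι * (1584 * (Z * S)) := by
    linarith
  linarith [le_of_mul_le_mul_left hquadratic (by positivity)]

end HasCoulombBounds

end LiebArgument

open scoped ComplexConjugate

section Determinant

theorem perm_eq_of_forall_ne {α : Type*} {σ τ : Equiv.Perm α} (j : α)
    (h : ∀ l, l ≠ j → σ l = τ l) : σ = τ := by
  have hj : σ j = τ j := by
    obtain ⟨l, hl⟩ := σ.surjective (τ j)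
    rcases eq_or_ne l j with rfl | hlj
    · exact hl
    · exact absurd (τ.injective ((h l hlj).symm.trans hl)) hlj
  ext l
  rcases eq_or_ne l j with rfl | hlj
  exacts [hj, h l hlj]

variable {ι : Type*} [Fintype ι] [DecidableEq ι]

theorem card_nsmul_sum_perm_apply {A : Type*} [AddCommMonoid A] (a : ι → A) (j : ι) :
    Fintype.card ι • ∑ σ : Equiv.Perm ι, a (σ j) = (Fintype.card ι).factorial • ∑ k, a k := by
  have htransitive : ∀ i, ∑ σ : Equiv.Perm ι, a (σ i) = ∑ σ : Equiv.Perm ι, a (σ j) := fun i => by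
    rw [← Equiv.sum_comp (Equiv.mulRight (Equiv.swap i j))]
    simp
  calc Fintype.card ι • ∑ σ : Equiv.Perm ι, a (σ j)
      = ∑ i, ∑ σ : Equiv.Perm ι, a (σ i) := by simp [htransitive]
    _ = ∑ σ : Equiv.Perm ι, ∑ i, a i := by
        rw [Finset.sum_comm]
        exact Finset.sum_congr rfl fun σ _ => Equiv.sum_comp σ a
    _ = (Fintype.card ι).factorial • ∑ k, a k := by simp [Fintype.card_perm]

theorem det_mul_det_eq_sum_sum {R : Type*} [CommRing R] (A B : Matrix ι ι R) :
    A.det * B.det = ∑ σ : Equiv.Perm ι, ∑ τ : Equiv.Perm ι,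
      (Equiv.Perm.sign σ * Equiv.Perm.sign τ : ℤ) * ∏ l, A l (σ l) * B l (τ l) := by
  rw [← A.det_transpose, ← B.det_transpose, Matrix.det_apply', Matrix.det_apply',
    Finset.sum_mul_sum]
  refine Finset.sum_congr rfl fun σ _ => Finset.sum_congr rfl fun τ _ => ?_
  rw [Finset.prod_mul_distrib, Int.cast_mul]
  exact mul_mul_mul_comm _ _ _ _

theorem norm_det_sq_mul_eq {X : Type*} (φ : ι → X → ℂ) (F : X → ℝ) (x : ι → X) (j : ι) :
    ((‖(Matrix.of fun i k => φ k (x i)).det‖ ^ 2 * F (x j) : ℝ) : ℂ) =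
      ∑ σ : Equiv.Perm ι, ∑ τ : Equiv.Perm ι, (Equiv.Perm.sign σ * Equiv.Perm.sign τ : ℤ) *
        ((∏ l, φ (σ l) (x l) * conj (φ (τ l) (x l))) * F (x j)) := by
  have hconj : conj (Matrix.of fun i k => φ k (x i)).det =
      (Matrix.of fun i k => conj (φ k (x i))).det := RingHom.map_det _ _
  push_cast
  rw [← Complex.mul_conj', hconj, det_mul_det_eq_sum_sum]
  simp only [Finset.sum_mul, Matrix.of_apply, mul_assoc _ (Finset.prod _ _), Int.cast_mul]

end Determinant

section OneBodyDensity

variable {ι X : Type*} [DecidableEq ι] [MeasurableSpace X] {μ : Measure X}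

theorem integrable_mul_conj_mul {f g : X → ℂ} {F : X → ℝ} (hf : AEStronglyMeasurable f μ)
    (hg : AEStronglyMeasurable g μ) (hF : AEStronglyMeasurable F μ)
    (hfF : Integrable (fun z => ‖f z‖ ^ 2 * F z) μ)
    (hgF : Integrable (fun z => ‖g z‖ ^ 2 * F z) μ) :
    Integrable (fun z => f z * conj (g z) * F z) μ := by
  refine (hfF.norm.add hgF.norm).mono'
    ((hf.mul (Complex.continuous_conj.comp_aestronglyMeasurable hg)).mul
      (Complex.continuous_ofReal.comp_aestronglyMeasurable hF)) (.of_forall fun z => ?_)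
  have hamgm : ‖f z‖ * ‖g z‖ ≤ ‖f z‖ ^ 2 + ‖g z‖ ^ 2 := by
    nlinarith [two_mul_le_add_sq ‖f z‖ ‖g z‖, sq_nonneg ‖f z‖, sq_nonneg ‖g z‖]
  simpa [add_mul] using mul_le_mul_of_nonneg_right hamgm (abs_nonneg (F z))

/-- Orthonormality in `L²(μ)`, for a system of functions rather than of classes of functions. -/
structure IsOrthonormalSystem (φ : ι → X → ℂ) (μ : Measure X) : Prop where
  aestronglyMeasurable : ∀ k, AEStronglyMeasurable (φ k) μ
  integrable_norm_sq : ∀ k, Integrable (fun z => ‖φ k z‖ ^ 2) μ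
  integral_mul_conj : ∀ k l, ∫ z, φ k z * conj (φ l z) ∂μ = if k = l then 1 else 0

namespace IsOrthonormalSystem

variable {φ : ι → X → ℂ}

theorem integrable_mul_conj (h : IsOrthonormalSystem φ μ) (k l : ι) :
    Integrable (fun z => φ k z * conj (φ l z)) μ := by
  simpa using integrable_mul_conj_mul (F := 1) (h.aestronglyMeasurable k)
    (h.aestronglyMeasurable l) aestronglyMeasurable_const
    (by simpa using h.integrable_norm_sq k) (by simpa using h.integrable_norm_sq l)

variable [Fintype ι] [SigmaFinite μ] {F : X → ℝ}

theorem integrable_prod_mul_conj_mul (h : IsOrthonormalSystem φ μ)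
    (hF : AEStronglyMeasurable F μ) (hφF : ∀ k, Integrable (fun z => ‖φ k z‖ ^ 2 * F z) μ)
    (σ τ : Equiv.Perm ι) (j : ι) :
    Integrable (fun x : ι → X => (∏ l, φ (σ l) (x l) * conj (φ (τ l) (x l))) * F (x j))
      (Measure.pi fun _ => μ) := by
  have hfactor : ∀ l, Integrable (fun z => φ (σ l) z * conj (φ (τ l) z) *
      if l = j then (F z : ℂ) else 1) μ := fun l => by
    split_ifs
    · exact integrable_mul_conj_mul (h.aestronglyMeasurable _) (h.aestronglyMeasurable _) hF
        (hφF _) (hφF _)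
    · simpa only [mul_one] using h.integrable_mul_conj _ _
  have hprod := Integrable.fintype_prod (μ := fun _ => μ) hfactor
  simp only [Finset.prod_mul_distrib, Finset.prod_ite_eq', Finset.mem_univ, if_true] at hprod ⊢
  exact hprod

theorem integral_prod_mul_conj_mul (h : IsOrthonormalSystem φ μ) (F : X → ℝ)
    (σ τ : Equiv.Perm ι) (j : ι) :
    ∫ x : ι → X, (∏ l, φ (σ l) (x l) * conj (φ (τ l) (x l))) * F (x j)
        ∂(Measure.pi fun _ => μ) =
      if σ = τ then ((∫ z, ‖φ (σ j) z‖ ^ 2 * F z ∂μ : ℝ) : ℂ) else 0 := by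
  have hFubini := integral_fintype_prod_eq_prod (μ := fun _ => μ) (fun l z =>
    φ (σ l) z * conj (φ (τ l) z) * if l = j then (F z : ℂ) else 1)
  simp only [Finset.prod_mul_distrib, Finset.prod_ite_eq', Finset.mem_univ, if_true] at hFubini ⊢
  rw [hFubini]
  split_ifs with hστ
  · rw [← hστ, Finset.prod_eq_single j]
    · simp only [if_true, Complex.mul_conj', ← integral_complex_ofReal]
      push_cast
      rfl
    · intro l _ hl
      simp [hl, h.integral_mul_conj]
    · simp
  · obtain ⟨l, hl, hne⟩ : ∃ l, l ≠ j ∧ σ l ≠ τ l := by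
      by_contra! hcon
      exact hστ (perm_eq_of_forall_ne j hcon)
    refine Finset.prod_eq_zero (Finset.mem_univ l) ?_
    simp [hl, h.integral_mul_conj, hne]

theorem integrable_norm_det_sq_mul (h : IsOrthonormalSystem φ μ)
    (hF : AEStronglyMeasurable F μ) (hφF : ∀ k, Integrable (fun z => ‖φ k z‖ ^ 2 * F z) μ)
    (j : ι) :
    Integrable (fun x : ι → X => ‖(Matrix.of fun i k => φ k (x i)).det‖ ^ 2 * F (x j))
      (Measure.pi fun _ => μ) := by
  refine Integrable.re (𝕜 := ℂ)
    (f := fun x : ι → X => ((‖(Matrix.of fun i k => φ k (x i)).det‖ ^ 2 * F (x j) : ℝ) : ℂ)) ?_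
  simp only [norm_det_sq_mul_eq]
  exact integrable_finsetSum _ fun σ _ => integrable_finsetSum _ fun τ _ =>
    (h.integrable_prod_mul_conj_mul hF hφF σ τ j).const_mul _

theorem card_mul_integral_norm_det_sq_mul (h : IsOrthonormalSystem φ μ)
    (hF : AEStronglyMeasurable F μ) (hφF : ∀ k, Integrable (fun z => ‖φ k z‖ ^ 2 * F z) μ)
    (j : ι) :
    Fintype.card ι * ∫ x : ι → X, ‖(Matrix.of fun i k => φ k (x i)).det‖ ^ 2 * F (x j)
        ∂(Measure.pi fun _ => μ) =
      (Fintype.card ι).factorial * ∑ k, ∫ z, ‖φ k z‖ ^ 2 * F z ∂μ := by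
  have hterm : ∀ σ τ : Equiv.Perm ι, Integrable (fun x : ι → X =>
      ((Equiv.Perm.sign σ * Equiv.Perm.sign τ : ℤ) : ℂ) *
        ((∏ l, φ (σ l) (x l) * conj (φ (τ l) (x l))) * F (x j))) (Measure.pi fun _ => μ) :=
    fun σ τ => (h.integrable_prod_mul_conj_mul hF hφF σ τ j).const_mul _
  have hsum : ∫ x : ι → X, ‖(Matrix.of fun i k => φ k (x i)).det‖ ^ 2 * F (x j)
        ∂(Measure.pi fun _ => μ) =
      ∑ σ : Equiv.Perm ι, ∫ z, ‖φ (σ j) z‖ ^ 2 * F z ∂μ := by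
    apply Complex.ofReal_injective
    rw [← integral_complex_ofReal]
    simp only [norm_det_sq_mul_eq]
    rw [integral_finsetSum _ fun σ _ => integrable_finsetSum _ fun τ _ => hterm σ τ]
    simp only [integral_finsetSum _ fun τ _ => hterm _ τ, integral_const_mul,
      h.integral_prod_mul_conj_mul F]
    simp [← Units.val_mul]
  simpa only [hsum, nsmul_eq_mul] using
    card_nsmul_sum_perm_apply (fun k => ∫ z, ‖φ k z‖ ^ 2 * F z ∂μ) j

end IsOrthonormalSystem

end OneBodyDensity

section LandauStates

theorem continuous_landau (m : ℕ) : Continuous (landau m) := by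
  unfold landau
  fun_prop

theorem norm_landau_sq (m : ℕ) (z : ℂ) :
    ‖landau m z‖ ^ 2 = (Real.pi * m.factorial)⁻¹ * (‖z‖ ^ (2 * m) * Real.exp (-‖z‖ ^ 2)) := by
  have hexp : Real.exp (-‖z‖ ^ 2) = Real.exp (-‖z‖ ^ 2 / 2) ^ 2 := by
    rw [← Real.exp_nat_mul]
    congr 1
    push_cast
    ring
  rw [landau, norm_mul, norm_pow, RCLike.norm_conj, Complex.norm_real, Real.norm_eq_abs, mul_pow,
    sq_abs, mul_pow, inv_pow, Real.sq_sqrt (by positivity), hexp]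
  ring

theorem integral_norm_pow_mul_exp (k : ℕ) :
    ∫ z : ℂ, ‖z‖ ^ k * Real.exp (-‖z‖ ^ 2) = Real.pi * Real.Gamma ((k + 2) / 2) := by
  have hGamma := Complex.integral_rpow_mul_exp_neg_rpow (p := 2) (q := k) one_le_two
    ((neg_lt_zero.2 two_pos).trans_le k.cast_nonneg)
  simp only [Real.rpow_natCast, Real.rpow_two] at hGamma
  rw [hGamma]
  ring

theorem integrable_norm_pow_mul_exp (k : ℕ) :
    Integrable fun z : ℂ => ‖z‖ ^ k * Real.exp (-‖z‖ ^ 2) := by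
  refine Integrable.of_integral_ne_zero ?_
  rw [integral_norm_pow_mul_exp]
  exact (mul_pos Real.pi_pos (Real.Gamma_pos_of_pos (by positivity))).ne'

theorem norm_landau_sq_mul_pow (m k : ℕ) (z : ℂ) :
    ‖landau m z‖ ^ 2 * ‖z‖ ^ k =
      (Real.pi * m.factorial)⁻¹ * (‖z‖ ^ (2 * m + k) * Real.exp (-‖z‖ ^ 2)) := by
  rw [norm_landau_sq]
  ring

theorem integrable_norm_landau_sq_mul_pow (m k : ℕ) :
    Integrable fun z => ‖landau m z‖ ^ 2 * ‖z‖ ^ k := by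
  simpa only [norm_landau_sq_mul_pow] using (integrable_norm_pow_mul_exp _).const_mul _

theorem integral_norm_landau_sq_mul_pow (m k : ℕ) :
    ∫ z, ‖landau m z‖ ^ 2 * ‖z‖ ^ (2 * k) = (m + k).factorial / m.factorial := by
  have hGamma : ((2 * m + 2 * k : ℕ) + 2 : ℝ) / 2 = (m + k : ℕ) + 1 := by
    push_cast
    ring
  simp only [norm_landau_sq_mul_pow]
  rw [integral_const_mul, integral_norm_pow_mul_exp, hGamma, Real.Gamma_nat_eq_factorial]
  field_simp

theorem integrable_norm_landau_sq (m : ℕ) : Integrable fun z => ‖landau m z‖ ^ 2 := by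
  simpa using integrable_norm_landau_sq_mul_pow m 0

theorem integral_norm_landau_sq (m : ℕ) : ∫ z, ‖landau m z‖ ^ 2 = 1 := by
  simpa [Nat.factorial_ne_zero] using integral_norm_landau_sq_mul_pow m 0

theorem landau_mul_of_norm_eq_one (m : ℕ) {c : ℂ} (hc : ‖c‖ = 1) (z : ℂ) :
    landau m (c * z) = conj c ^ m * landau m z := by
  simp only [landau, norm_mul, hc, one_mul, map_mul, mul_pow]
  ring

/-- The rotation by `π / (n - m)` changes the sign of the integrand. -/
theorem integral_landau_mul_conj_of_ne {m n : ℕ} (hmn : m ≠ n) :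
    ∫ z, landau m z * conj (landau n z) = 0 := by
  have hne : (n : ℂ) - m ≠ 0 := sub_ne_zero.2 (by exact_mod_cast hmn.symm)
  let c : Circle := Circle.exp (Real.pi / ((n : ℝ) - m))
  have hphase : conj (c : ℂ) ^ m * (c : ℂ) ^ n = -1 := by
    rw [Circle.coe_exp, ← Complex.exp_conj, ← Complex.exp_nat_mul, ← Complex.exp_nat_mul,
      ← Complex.exp_add, ← Complex.exp_pi_mul_I]
    congr 1
    simp only [map_mul, Complex.conj_ofReal, Complex.conj_I]
    push_cast
    field_simp
    ring
  have hrotate : ∀ z, landau m (rotation c z) * conj (landau n (rotation c z)) =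
      -(landau m z * conj (landau n z)) := fun z => by
    rw [rotation_apply, landau_mul_of_norm_eq_one m (Circle.norm_coe c),
      landau_mul_of_norm_eq_one n (Circle.norm_coe c), map_mul, map_pow, Complex.conj_conj,
      mul_mul_mul_comm, hphase, neg_one_mul]
  have hinvariant := (rotation c).measurePreserving.integral_comp
    (rotation c).toHomeomorph.measurableEmbedding fun z => landau m z * conj (landau n z)
  simp only [hrotate, integral_neg] at hinvariant
  exact self_eq_neg.1 hinvariant.symm

theorem isOrthonormalSystem_landau (N : ℕ) :
    IsOrthonormalSystem (fun k : Fin N => landau k) volume where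
  aestronglyMeasurable k := (continuous_landau k).aestronglyMeasurable
  integrable_norm_sq k := integrable_norm_landau_sq k
  integral_mul_conj k l := by
    split_ifs with hkl
    · simp only [hkl, Complex.mul_conj', ← Complex.ofReal_pow]
      rw [integral_complex_ofReal, integral_norm_landau_sq, Complex.ofReal_one]
    · exact integral_landau_mul_conj_of_ne (Fin.val_injective.ne hkl)

theorem sum_norm_landau_sq_le (N : ℕ) (z : ℂ) :
    ∑ k : Fin N, ‖landau k z‖ ^ 2 ≤ Real.pi⁻¹ := by
  calc ∑ k : Fin N, ‖landau k z‖ ^ 2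
      = Real.pi⁻¹ * Real.exp (-‖z‖ ^ 2) *
          ∑ k ∈ Finset.range N, (‖z‖ ^ 2) ^ k / k.factorial := by
        rw [Fin.sum_univ_eq_sum_range fun k => ‖landau k z‖ ^ 2, Finset.mul_sum]
        refine Finset.sum_congr rfl fun k _ => ?_
        rw [norm_landau_sq, ← pow_mul]
        field_simp
    _ ≤ Real.pi⁻¹ * Real.exp (-‖z‖ ^ 2) * Real.exp (‖z‖ ^ 2) := by
        gcongr
        exact Real.sum_le_exp_of_nonneg (sq_nonneg ‖z‖) N
    _ = Real.pi⁻¹ := by rw [mul_assoc, ← Real.exp_add, neg_add_cancel, Real.exp_zero, mul_one]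

theorem norm_landau_sq_le (m : ℕ) (z : ℂ) : ‖landau m z‖ ^ 2 ≤ Real.pi⁻¹ :=
  (Finset.single_le_sum (f := fun k : Fin (m + 1) => ‖landau k z‖ ^ 2)
    (fun _ _ => sq_nonneg _) (Finset.mem_univ (Fin.last m))).trans (sum_norm_landau_sq_le (m + 1) z)

end LandauStates

section SlaterDeterminant

variable {N : ℕ}

theorem continuous_slater (N : ℕ) : Continuous (slater N) := by
  unfold slater
  refine continuous_const.mul (Continuous.matrix_det (continuous_matrix fun j k => ?_))
  exact (continuous_landau k).comp (continuous_apply j)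

theorem slater_eq_zero_of_eq {ζ : Fin N → ℂ} {j k : Fin N} (hjk : j ≠ k) (hζ : ζ j = ζ k) :
    slater N ζ = 0 := by
  rw [slater, Matrix.det_zero_of_row_eq hjk (by ext; simp [hζ]), mul_zero]

theorem norm_slater_sq (ζ : Fin N → ℂ) :
    ‖slater N ζ‖ ^ 2 =
      (N.factorial : ℝ)⁻¹ * ‖(Matrix.of fun j k : Fin N => landau k (ζ j)).det‖ ^ 2 := by
  rw [slater, norm_mul, mul_pow, Complex.norm_real, Real.norm_eq_abs, sq_abs, inv_pow,
    Real.sq_sqrt N.factorial.cast_nonneg]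

theorem integrable_norm_slater_sq_mul {F : ℂ → ℝ} (hF : AEStronglyMeasurable F)
    (hφF : ∀ k : Fin N, Integrable fun z => ‖landau k z‖ ^ 2 * F z) (j : Fin N) :
    Integrable fun ζ : Fin N → ℂ => ‖slater N ζ‖ ^ 2 * F (ζ j) := by
  simp only [norm_slater_sq, mul_assoc]
  exact ((isOrthonormalSystem_landau N).integrable_norm_det_sq_mul hF hφF j).const_mul _

theorem card_mul_integral_norm_slater_sq_mul {F : ℂ → ℝ} (hF : AEStronglyMeasurable F)
    (hφF : ∀ k : Fin N, Integrable fun z => ‖landau k z‖ ^ 2 * F z) (j : Fin N) :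
    N * ∫ ζ : Fin N → ℂ, ‖slater N ζ‖ ^ 2 * F (ζ j) =
      ∑ k : Fin N, ∫ z, ‖landau k z‖ ^ 2 * F z := by
  have hdet := (isOrthonormalSystem_landau N).card_mul_integral_norm_det_sq_mul hF hφF j
  rw [Fintype.card_fin, ← volume_pi] at hdet
  simp only [norm_slater_sq, mul_assoc, integral_const_mul]
  rw [mul_left_comm, hdet, inv_mul_cancel_left₀ (by positivity)]

theorem integrable_norm_slater_sq_mul_pow (k : ℕ) (j : Fin N) :
    Integrable fun ζ : Fin N → ℂ => ‖slater N ζ‖ ^ 2 * ‖ζ j‖ ^ k :=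
  integrable_norm_slater_sq_mul (F := fun z => ‖z‖ ^ k) (by fun_prop)
    (fun m => integrable_norm_landau_sq_mul_pow m k) j

theorem card_mul_integral_norm_slater_sq_mul_pow (k : ℕ) (j : Fin N) :
    N * ∫ ζ : Fin N → ℂ, ‖slater N ζ‖ ^ 2 * ‖ζ j‖ ^ (2 * k) =
      ∑ m : Fin N, (((m : ℕ) + k).factorial / (m : ℕ).factorial : ℝ) := by
  rw [card_mul_integral_norm_slater_sq_mul (F := fun z => ‖z‖ ^ (2 * k)) (by fun_prop)
    (fun m => integrable_norm_landau_sq_mul_pow m (2 * k)) j]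
  exact Finset.sum_congr rfl fun m _ => integral_norm_landau_sq_mul_pow m k

theorem integrable_norm_slater_sq (j : Fin N) :
    Integrable fun ζ : Fin N → ℂ => ‖slater N ζ‖ ^ 2 := by
  simpa using integrable_norm_slater_sq_mul_pow 0 j

theorem integral_norm_slater_sq (j : Fin N) :
    ∫ ζ : Fin N → ℂ, ‖slater N ζ‖ ^ 2 = 1 := by
  have hN : (N : ℝ) ≠ 0 := by exact_mod_cast j.pos.ne'
  have hmass := card_mul_integral_norm_slater_sq_mul_pow 0 j
  simpa [Nat.factorial_ne_zero, hN] using hmass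

theorem integral_norm_slater_sq_mul_norm_sq_le (j : Fin N) :
    ∫ ζ : Fin N → ℂ, ‖slater N ζ‖ ^ 2 * ‖ζ j‖ ^ 2 ≤ N := by
  have hN : (0 : ℝ) < N := by exact_mod_cast j.pos
  refine le_of_mul_le_mul_left ?_ hN
  calc N * ∫ ζ : Fin N → ℂ, ‖slater N ζ‖ ^ 2 * ‖ζ j‖ ^ 2
      = ∑ m : Fin N, (((m : ℕ) + 1).factorial / (m : ℕ).factorial : ℝ) :=
        card_mul_integral_norm_slater_sq_mul_pow 1 j
    _ ≤ ∑ _m : Fin N, (N : ℝ) := Finset.sum_le_sum fun m _ => by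
        rw [Nat.factorial_succ, Nat.cast_mul, mul_div_cancel_right₀ _ (by positivity)]
        exact_mod_cast m.2
    _ = N * N := by simp

end SlaterDeterminant

section PlanarCoulomb

variable {ρ : ℂ → ℝ} {c R : ℝ}

theorem integral_inv_norm_mul_exp (hR : 0 < R) :
    ∫ z : ℂ, ‖z‖⁻¹ * Real.exp (-R⁻¹ * ‖z‖) = 2 * Real.pi * R := by
  have hGamma := Complex.integral_rpow_mul_exp_neg_mul_rpow (p := 1) (q := -1) le_rfl
    (by norm_num) (inv_pos.2 hR)
  norm_num [Real.rpow_neg_one] at hGamma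
  simpa only [neg_mul] using hGamma

theorem integrable_inv_norm_mul_exp (hR : 0 < R) :
    Integrable fun z : ℂ => ‖z‖⁻¹ * Real.exp (-R⁻¹ * ‖z‖) := by
  refine Integrable.of_integral_ne_zero ?_
  rw [integral_inv_norm_mul_exp hR]
  positivity

theorem inv_sqrt_sq_add_sq_le_inv_abs {x : ℝ} (hx : x ≠ 0) (r : ℝ) :
    (√(x ^ 2 + r ^ 2))⁻¹ ≤ |x|⁻¹ :=
  inv_anti₀ (abs_pos.2 hx) (Real.abs_le_sqrt (le_add_of_nonneg_right (sq_nonneg r)))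

theorem sqrt_mul_inv_sqrt_le (hR : 0 < R) (x : ℝ) {r : ℝ} (hr : 0 < r) :
    √(x ^ 2 + R ^ 2) * (√(x ^ 2 + r ^ 2))⁻¹ ≤ 2 + R * (r⁻¹ * Real.exp (-R⁻¹ * r)) := by
  have htriangle : √(x ^ 2 + R ^ 2) ≤ |x| + R :=
    Real.sqrt_le_iff.2 ⟨by positivity, by nlinarith [sq_abs x, abs_nonneg x]⟩
  have hlongitudinal : |x| * (√(x ^ 2 + r ^ 2))⁻¹ ≤ 1 := by
    rw [← div_eq_mul_inv]
    exact div_le_one_of_le₀ (Real.abs_le_sqrt (le_add_of_nonneg_right (sq_nonneg r)))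
      (Real.sqrt_nonneg _)
  have hexp : 1 ≤ R⁻¹ * r + Real.exp (-R⁻¹ * r) := by
    linarith [Real.add_one_le_exp (-R⁻¹ * r)]
  have htransverse : R * r⁻¹ ≤ 1 + R * (r⁻¹ * Real.exp (-R⁻¹ * r)) :=
    calc R * r⁻¹ ≤ R * r⁻¹ * (R⁻¹ * r + Real.exp (-R⁻¹ * r)) :=
          le_mul_of_one_le_right (by positivity) hexp
      _ = 1 + R * (r⁻¹ * Real.exp (-R⁻¹ * r)) := by field_simp
  calc √(x ^ 2 + R ^ 2) * (√(x ^ 2 + r ^ 2))⁻¹ ≤ (|x| + R) * (√(x ^ 2 + r ^ 2))⁻¹ := by gcongr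
    _ = |x| * (√(x ^ 2 + r ^ 2))⁻¹ + R * (√(x ^ 2 + r ^ 2))⁻¹ := add_mul _ _ _
    _ ≤ 1 + R * r⁻¹ := by
        gcongr
        exact Real.le_sqrt_of_sq_le (le_add_of_nonneg_left (sq_nonneg x))
    _ ≤ 2 + R * (r⁻¹ * Real.exp (-R⁻¹ * r)) := by linarith

theorem sqrt_mul_mul_inv_sqrt_ae_le (hρ₀ : ∀ z, 0 ≤ ρ z) (hρc : ∀ z, ρ z ≤ c) (hR : 0 < R)
    (x : ℝ) : ∀ᵐ z, √(x ^ 2 + R ^ 2) * (ρ z * (√(x ^ 2 + ‖z‖ ^ 2))⁻¹) ≤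
      2 * ρ z + c * R * (‖z‖⁻¹ * Real.exp (-R⁻¹ * ‖z‖)) := by
  filter_upwards [Measure.ae_ne volume (0 : ℂ)] with z hz
  calc √(x ^ 2 + R ^ 2) * (ρ z * (√(x ^ 2 + ‖z‖ ^ 2))⁻¹)
      = ρ z * (√(x ^ 2 + R ^ 2) * (√(x ^ 2 + ‖z‖ ^ 2))⁻¹) := by ring
    _ ≤ ρ z * (2 + R * (‖z‖⁻¹ * Real.exp (-R⁻¹ * ‖z‖))) :=
        mul_le_mul_of_nonneg_left (sqrt_mul_inv_sqrt_le hR x (norm_pos_iff.2 hz)) (hρ₀ z)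
    _ = 2 * ρ z + ρ z * (R * (‖z‖⁻¹ * Real.exp (-R⁻¹ * ‖z‖))) := by ring
    _ ≤ 2 * ρ z + c * (R * (‖z‖⁻¹ * Real.exp (-R⁻¹ * ‖z‖))) := by
        gcongr
        exact hρc z
    _ = 2 * ρ z + c * R * (‖z‖⁻¹ * Real.exp (-R⁻¹ * ‖z‖)) := by rw [mul_assoc c]

theorem integrable_mul_inv_sqrt (hρ : Integrable ρ) (hρ₀ : ∀ z, 0 ≤ ρ z) (hρc : ∀ z, ρ z ≤ c)
    (x : ℝ) : Integrable fun z => ρ z * (√(x ^ 2 + ‖z‖ ^ 2))⁻¹ := by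
  refine ((hρ.const_mul 2).add ((integrable_inv_norm_mul_exp one_pos).const_mul (c * 1))).mono'
    (hρ.aestronglyMeasurable.mul (by fun_prop)) ?_
  filter_upwards [sqrt_mul_mul_inv_sqrt_ae_le hρ₀ hρc one_pos x] with z hz
  have hnonneg : 0 ≤ ρ z * (√(x ^ 2 + ‖z‖ ^ 2))⁻¹ := mul_nonneg (hρ₀ z) (by positivity)
  have hone : 1 ≤ √(x ^ 2 + 1 ^ 2) := Real.one_le_sqrt.2 (by linarith [sq_nonneg x])
  rw [Real.norm_of_nonneg hnonneg]
  exact (le_mul_of_one_le_left hnonneg hone).trans hz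

theorem sqrt_mul_integral_mul_inv_sqrt_le (hρ : Integrable ρ) (hρ₀ : ∀ z, 0 ≤ ρ z)
    (hρc : ∀ z, ρ z ≤ c) (hR : 0 < R) (x : ℝ) :
    √(x ^ 2 + R ^ 2) * ∫ z, ρ z * (√(x ^ 2 + ‖z‖ ^ 2))⁻¹ ≤
      2 * (∫ z, ρ z) + 2 * Real.pi * c * R ^ 2 := by
  have htail := (integrable_inv_norm_mul_exp hR).const_mul (c * R)
  calc √(x ^ 2 + R ^ 2) * ∫ z, ρ z * (√(x ^ 2 + ‖z‖ ^ 2))⁻¹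
      = ∫ z, √(x ^ 2 + R ^ 2) * (ρ z * (√(x ^ 2 + ‖z‖ ^ 2))⁻¹) := (integral_const_mul _ _).symm
    _ ≤ ∫ z, 2 * ρ z + c * R * (‖z‖⁻¹ * Real.exp (-R⁻¹ * ‖z‖)) :=
        integral_mono_ae ((integrable_mul_inv_sqrt hρ hρ₀ hρc x).const_mul _)
          ((hρ.const_mul 2).add htail) (sqrt_mul_mul_inv_sqrt_ae_le hρ₀ hρc hR x)
    _ = 2 * (∫ z, ρ z) + 2 * Real.pi * c * R ^ 2 := by
        rw [integral_add (hρ.const_mul 2) htail, integral_const_mul, integral_const_mul,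
          integral_inv_norm_mul_exp hR]
        ring

end PlanarCoulomb

section EffectiveAttraction

variable {N : ℕ}

theorem measurable_effV (j : Fin N) : Measurable (effV (slater N) j) := by
  have hslater := (continuous_slater N).measurable
  have hjoint : Measurable fun p : ℝ × (Fin N → ℂ) =>
      ‖slater N p.2‖ ^ 2 / √(p.1 ^ 2 + ‖p.2 j‖ ^ 2) := by fun_prop
  exact hjoint.stronglyMeasurable.integral_prod_right.measurable

theorem effV_nonneg (U : (Fin N → ℂ) → ℂ) (j : Fin N) (x : ℝ) : 0 ≤ effV U j x :=
  integral_nonneg fun ζ => by positivity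

theorem card_mul_effV_slater (j : Fin N) (x : ℝ) :
    N * effV (slater N) j x =
      ∫ z, (∑ k : Fin N, ‖landau k z‖ ^ 2) * (√(x ^ 2 + ‖z‖ ^ 2))⁻¹ := by
  have hint : ∀ k : Fin N, Integrable fun z => ‖landau k z‖ ^ 2 * (√(x ^ 2 + ‖z‖ ^ 2))⁻¹ :=
    fun k => integrable_mul_inv_sqrt (integrable_norm_landau_sq k) (fun z => sq_nonneg _)
      (norm_landau_sq_le k) x
  simp only [Finset.sum_mul]
  rw [integral_finsetSum _ fun k _ => hint k]
  exact card_mul_integral_norm_slater_sq_mul (F := fun z => (√(x ^ 2 + ‖z‖ ^ 2))⁻¹)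
    (by fun_prop) hint j

theorem effV_slater_le (j : Fin N) (x : ℝ) :
    effV (slater N) j x ≤ 4 * (√(x ^ 2 + N))⁻¹ := by
  have hN : (0 : ℝ) < N := by exact_mod_cast j.pos
  have hdensity : Integrable fun z => ∑ k : Fin N, ‖landau k z‖ ^ 2 :=
    integrable_finsetSum _ fun k _ => integrable_norm_landau_sq k
  have hmass : ∫ z, ∑ k : Fin N, ‖landau k z‖ ^ 2 = N := by
    rw [integral_finsetSum Finset.univ fun (k : Fin N) _ => integrable_norm_landau_sq k]
    simp [integral_norm_landau_sq]
  have hbound := sqrt_mul_integral_mul_inv_sqrt_le hdensity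
    (fun z => Finset.sum_nonneg fun k _ => sq_nonneg _) (sum_norm_landau_sq_le N)
    (Real.sqrt_pos.2 hN) x
  rw [hmass, ← card_mul_effV_slater j x, Real.sq_sqrt hN.le] at hbound
  rw [← div_eq_mul_inv, le_div_iff₀ (by positivity), mul_comm]
  refine le_of_mul_le_mul_left ?_ hN
  calc N * (√(x ^ 2 + N) * effV (slater N) j x)
      = √(x ^ 2 + N) * (N * effV (slater N) j x) := by ring
    _ ≤ 2 * N + 2 * Real.pi * Real.pi⁻¹ * N := hbound
    _ = N * 4 := by
        field_simp
        ring

theorem isBoundedMeasurable_effV_slater (j : Fin N) :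
    IsBoundedMeasurable (effV (slater N) j) := by
  have hN : (0 : ℝ) < N := by exact_mod_cast j.pos
  refine .of_nonneg_of_le (D := 4 * (√N)⁻¹) (measurable_effV j) (effV_nonneg _ j) fun x =>
    (effV_slater_le j x).trans ?_
  gcongr
  exact le_add_of_nonneg_left (sq_nonneg x)

end EffectiveAttraction

section Vandermonde

theorem norm_slater_eq {N : ℕ} (ζ : Fin N → ℂ) :
    ‖slater N ζ‖ = (√N.factorial)⁻¹ * (∏ k : Fin N, (√(Real.pi * (k : ℕ).factorial))⁻¹) *
      (∏ l, Real.exp (-‖ζ l‖ ^ 2 / 2)) * ∏ i, ∏ l ∈ Finset.Ioi i, ‖ζ l - ζ i‖ := by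
  have hmatrix : (Matrix.of fun j k : Fin N => landau (k : ℕ) (ζ j)) =
      Matrix.of fun j k : Fin N => ((Real.exp (-‖ζ j‖ ^ 2 / 2) : ℝ) : ℂ) *
        (Matrix.of fun j k : Fin N => (((√(Real.pi * (k : ℕ).factorial))⁻¹ : ℝ) : ℂ) *
          Matrix.vandermonde (fun j => conj (ζ j)) j k) j k := by
    ext j k
    simp only [Matrix.of_apply, Matrix.vandermonde_apply, landau]
    push_cast
    ring
  rw [slater, hmatrix, Matrix.det_mul_column, Matrix.det_mul_row, Matrix.det_vandermonde]
  simp only [norm_mul, norm_prod, Complex.norm_real, ← map_sub, RCLike.norm_conj, norm_inv,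
    Real.norm_of_nonneg (Real.sqrt_nonneg _), Real.norm_of_nonneg (Real.exp_pos _).le]
  ring

variable {ι E : Type*} [SeminormedAddCommGroup E]

theorem one_le_prod_one_add_norm (s : Finset ι) (ζ : ι → E) : 1 ≤ ∏ l ∈ s, (1 + ‖ζ l‖) :=
  Finset.prod_const_one.symm.trans_le (Finset.prod_le_prod (fun _ _ => zero_le_one)
    fun _ _ => le_add_of_nonneg_right (norm_nonneg _))

variable [Fintype ι]

theorem one_add_norm_le_prod_one_add_norm (ζ : ι → E) (i : ι) :
    1 + ‖ζ i‖ ≤ ∏ l, (1 + ‖ζ l‖) := by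
  classical
  rw [← Finset.mul_prod_erase _ _ (Finset.mem_univ i)]
  exact le_mul_of_one_le_right (by positivity) (one_le_prod_one_add_norm _ ζ)

theorem norm_sub_le_prod_one_add_norm_sq (ζ : ι → E) (i l : ι) :
    ‖ζ l - ζ i‖ ≤ (∏ m, (1 + ‖ζ m‖)) ^ 2 := by
  have hprod : (1 + ‖ζ l‖) * (1 + ‖ζ i‖) ≤ (∏ m, (1 + ‖ζ m‖)) ^ 2 := by
    rw [sq]
    gcongr <;> apply one_add_norm_le_prod_one_add_norm
  nlinarith [norm_sub_le (ζ l) (ζ i), mul_nonneg (norm_nonneg (ζ l)) (norm_nonneg (ζ i))]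

theorem prod_norm_sub_sq_le (ζ : ι → E) {s : Finset (Σ _ : ι, ι)} {p : Σ _ : ι, ι}
    (hp : p ∈ s) :
    (∏ q ∈ s, ‖ζ q.2 - ζ q.1‖) ^ 2 ≤
      ‖ζ p.2 - ζ p.1‖ * (∏ l, (1 + ‖ζ l‖)) ^ (4 * s.card) := by
  classical
  have hprod : ∀ t ⊆ s, ∏ q ∈ t, ‖ζ q.2 - ζ q.1‖ ≤ (∏ l, (1 + ‖ζ l‖)) ^ (2 * s.card) :=
    fun t ht => by
      rw [pow_mul]
      calc ∏ q ∈ t, ‖ζ q.2 - ζ q.1‖ ≤ ((∏ l, (1 + ‖ζ l‖)) ^ 2) ^ t.card :=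
            (Finset.prod_le_prod (fun _ _ => norm_nonneg _) fun q _ =>
              norm_sub_le_prod_one_add_norm_sq ζ q.1 q.2).trans_eq (Finset.prod_const _)
        _ ≤ ((∏ l, (1 + ‖ζ l‖)) ^ 2) ^ s.card :=
            pow_le_pow_right₀ (one_le_pow₀ (one_le_prod_one_add_norm _ ζ)) (Finset.card_le_card ht)
  calc (∏ q ∈ s, ‖ζ q.2 - ζ q.1‖) ^ 2
      = ‖ζ p.2 - ζ p.1‖ * (∏ q ∈ s.erase p, ‖ζ q.2 - ζ q.1‖) * ∏ q ∈ s, ‖ζ q.2 - ζ q.1‖ := by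
        rw [Finset.mul_prod_erase _ (fun q => ‖ζ q.2 - ζ q.1‖) hp, sq]
    _ ≤ ‖ζ p.2 - ζ p.1‖ * (∏ l, (1 + ‖ζ l‖)) ^ (2 * s.card) *
          (∏ l, (1 + ‖ζ l‖)) ^ (2 * s.card) := by
        gcongr
        exacts [hprod _ (Finset.erase_subset _ _), hprod s subset_rfl]
    _ = ‖ζ p.2 - ζ p.1‖ * (∏ l, (1 + ‖ζ l‖)) ^ (4 * s.card) := by ring

theorem integrable_one_add_norm_pow_mul_exp (m : ℕ) :
    Integrable fun z : ℂ => (1 + ‖z‖) ^ m * Real.exp (-‖z‖ ^ 2) := by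
  have hbinomial : (fun z : ℂ => (1 + ‖z‖) ^ m * Real.exp (-‖z‖ ^ 2)) = fun z =>
      ∑ i ∈ Finset.range (m + 1), m.choose i * (‖z‖ ^ i * Real.exp (-‖z‖ ^ 2)) := by
    ext z
    rw [add_comm 1 ‖z‖, add_pow, Finset.sum_mul]
    exact Finset.sum_congr rfl fun i _ => by ring
  rw [hbinomial]
  exact integrable_finsetSum _ fun i _ => (integrable_norm_pow_mul_exp i).const_mul _

theorem exists_norm_slater_sq_le {N : ℕ} {j k : Fin N} (hjk : j < k) :
    ∃ (c : ℝ) (m : ℕ), ∀ ζ, ‖slater N ζ‖ ^ 2 ≤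
      ‖ζ j - ζ k‖ * (c * ∏ l, ((1 + ‖ζ l‖) ^ m * Real.exp (-‖ζ l‖ ^ 2))) := by
  let s : Finset (Σ _ : Fin N, Fin N) := Finset.univ.sigma fun i => Finset.Ioi i
  refine ⟨((√N.factorial)⁻¹ * ∏ k : Fin N, (√(Real.pi * (k : ℕ).factorial))⁻¹) ^ 2, 4 * s.card,
    fun ζ => ?_⟩
  have hgauss : (∏ l, Real.exp (-‖ζ l‖ ^ 2 / 2)) ^ 2 = ∏ l, Real.exp (-‖ζ l‖ ^ 2) := by
    rw [← Finset.prod_pow]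
    exact Finset.prod_congr rfl fun l _ => by rw [sq, ← Real.exp_add, add_halves]
  have hmem : (⟨j, k⟩ : Σ _ : Fin N, Fin N) ∈ s := by simp [s, hjk]
  have hvandermonde := prod_norm_sub_sq_le ζ hmem
  rw [norm_slater_eq, Finset.prod_sigma', mul_pow, mul_pow, hgauss, Finset.prod_mul_distrib,
    Finset.prod_pow, norm_sub_rev]
  refine (mul_le_mul_of_nonneg_left hvandermonde ?_).trans_eq (by ring)
  exact mul_nonneg (sq_nonneg _) (Finset.prod_nonneg fun l _ => (Real.exp_pos _).le)

theorem integrable_norm_slater_sq_div_norm_sub {N : ℕ} {j k : Fin N} (hjk : j < k) :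
    Integrable fun ζ : Fin N → ℂ => ‖slater N ζ‖ ^ 2 / ‖ζ j - ζ k‖ := by
  obtain ⟨c, m, hle⟩ := exists_norm_slater_sq_le hjk
  have hmajorant : Integrable fun ζ : Fin N → ℂ =>
      c * ∏ l, ((1 + ‖ζ l‖) ^ m * Real.exp (-‖ζ l‖ ^ 2)) :=
    (Integrable.fintype_prod fun _ => integrable_one_add_norm_pow_mul_exp m).const_mul c
  have hslater := (continuous_slater N).measurable
  refine hmajorant.norm.mono' (Measurable.aestronglyMeasurable (by fun_prop))
    (.of_forall fun ζ => ?_)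
  rw [Real.norm_of_nonneg (by positivity)]
  refine div_le_of_le_mul₀ (norm_nonneg _) (norm_nonneg _) ?_
  rw [mul_comm]
  exact (hle ζ).trans (mul_le_mul_of_nonneg_left (Real.le_norm_self _) (norm_nonneg _))

end Vandermonde

section Jensen

theorem tangent_le_inv_sqrt {s t : ℝ} (hs : 0 < s) (ht : 0 < t) :
    3 / 2 * (√t)⁻¹ - t⁻¹ * (√t)⁻¹ / 2 * s ≤ (√s)⁻¹ := by
  obtain ⟨v, hv, rfl⟩ : ∃ v, 0 < v ∧ v ^ 2 = s := ⟨√s, Real.sqrt_pos.2 hs, Real.sq_sqrt hs.le⟩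
  obtain ⟨w, hw, rfl⟩ : ∃ w, 0 < w ∧ w ^ 2 = t := ⟨√t, Real.sqrt_pos.2 ht, Real.sq_sqrt ht.le⟩
  rw [Real.sqrt_sq hv.le, Real.sqrt_sq hw.le, ← sub_nonneg]
  have hfactor : v⁻¹ - (3 / 2 * w⁻¹ - (w ^ 2)⁻¹ * w⁻¹ / 2 * v ^ 2) =
      (v - w) ^ 2 * (v + 2 * w) / (2 * v * w ^ 3) := by
    field_simp
    ring
  rw [hfactor]
  positivity

theorem inv_sqrt_le_integral_div_sqrt {α : Type*} [MeasurableSpace α] {μ : Measure α}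
    {ρ s : α → ℝ} {t : ℝ} (hρ₀ : ∀ a, 0 ≤ ρ a) (hρ₁ : ∫ a, ρ a ∂μ = 1) (hs : ∀ a, 0 ≤ s a)
    (hvanish : ∀ a, s a = 0 → ρ a = 0) (hmul : Integrable (fun a => ρ a * s a) μ)
    (hdiv : Integrable (fun a => ρ a / √(s a)) μ) (ht : ∫ a, ρ a * s a ∂μ ≤ t) :
    (√t)⁻¹ ≤ ∫ a, ρ a / √(s a) ∂μ := by
  rcases le_or_gt t 0 with ht₀ | ht₀
  · rw [Real.sqrt_eq_zero_of_nonpos ht₀, inv_zero]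
    exact integral_nonneg fun a => div_nonneg (hρ₀ a) (Real.sqrt_nonneg _)
  have hρ : Integrable ρ μ := .of_integral_ne_zero (by simp [hρ₁])
  have htangent : ∀ a, 3 / 2 * (√t)⁻¹ * ρ a - t⁻¹ * (√t)⁻¹ / 2 * (ρ a * s a) ≤
      ρ a / √(s a) := fun a => by
    rcases (hs a).eq_or_lt' with hs₀ | hs₀
    · simp [hvanish a hs₀]
    · rw [div_eq_mul_inv (ρ a)]
      linarith [mul_le_mul_of_nonneg_left (tangent_le_inv_sqrt hs₀ ht₀) (hρ₀ a)]
  calc (√t)⁻¹ = 3 / 2 * (√t)⁻¹ * 1 - t⁻¹ * (√t)⁻¹ / 2 * t := by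
        field_simp
        norm_num
    _ ≤ 3 / 2 * (√t)⁻¹ * (∫ a, ρ a ∂μ) - t⁻¹ * (√t)⁻¹ / 2 * (∫ a, ρ a * s a ∂μ) := by
        rw [hρ₁]
        gcongr
    _ = ∫ a, 3 / 2 * (√t)⁻¹ * ρ a - t⁻¹ * (√t)⁻¹ / 2 * (ρ a * s a) ∂μ := by
        rw [integral_sub (hρ.const_mul _) (hmul.const_mul _), integral_const_mul,
          integral_const_mul]
    _ ≤ ∫ a, ρ a / √(s a) ∂μ :=
        integral_mono ((hρ.const_mul _).sub (hmul.const_mul _)) hdiv htangent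

end Jensen

section EffectiveRepulsion

variable {N : ℕ} {j k : Fin N}

theorem measurable_effW (j k : Fin N) : Measurable (effW (slater N) j k) := by
  have hslater := (continuous_slater N).measurable
  have hjoint : Measurable fun p : ℝ × (Fin N → ℂ) =>
      ‖slater N p.2‖ ^ 2 / √(p.1 ^ 2 + ‖p.2 j - p.2 k‖ ^ 2) := by fun_prop
  exact hjoint.stronglyMeasurable.integral_prod_right.measurable

theorem effW_nonneg (U : (Fin N → ℂ) → ℂ) (j k : Fin N) (x : ℝ) : 0 ≤ effW U j k x :=
  integral_nonneg fun ζ => by positivity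

theorem norm_slater_sq_div_sqrt_le (hjk : j < k) (x : ℝ) (ζ : Fin N → ℂ) :
    ‖slater N ζ‖ ^ 2 / √(x ^ 2 + ‖ζ j - ζ k‖ ^ 2) ≤ ‖slater N ζ‖ ^ 2 / ‖ζ j - ζ k‖ := by
  rcases eq_or_ne (ζ j) (ζ k) with hζ | hζ
  · simp [slater_eq_zero_of_eq hjk.ne hζ]
  · have := norm_sub_pos_iff.2 hζ
    gcongr
    exact Real.le_sqrt_of_sq_le (le_add_of_nonneg_left (sq_nonneg x))

theorem integrable_norm_slater_sq_div_sqrt (hjk : j < k) (x : ℝ) :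
    Integrable fun ζ : Fin N → ℂ => ‖slater N ζ‖ ^ 2 / √(x ^ 2 + ‖ζ j - ζ k‖ ^ 2) := by
  have hslater := (continuous_slater N).measurable
  refine (integrable_norm_slater_sq_div_norm_sub hjk).mono'
    (Measurable.aestronglyMeasurable (by fun_prop)) (.of_forall fun ζ => ?_)
  rw [Real.norm_of_nonneg (by positivity)]
  exact norm_slater_sq_div_sqrt_le hjk x ζ

theorem isBoundedMeasurable_effW_slater (hjk : j < k) :
    IsBoundedMeasurable (effW (slater N) j k) :=
  .of_nonneg_of_le (measurable_effW j k) (effW_nonneg _ j k) fun x =>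
    integral_mono (integrable_norm_slater_sq_div_sqrt hjk x)
      (integrable_norm_slater_sq_div_norm_sub hjk) (norm_slater_sq_div_sqrt_le hjk x)

theorem effW_slater_le_inv_abs (hjk : j < k) {x : ℝ} (hx : x ≠ 0) :
    effW (slater N) j k x ≤ |x|⁻¹ :=
  calc effW (slater N) j k x ≤ ∫ ζ : Fin N → ℂ, ‖slater N ζ‖ ^ 2 * |x|⁻¹ :=
        integral_mono (integrable_norm_slater_sq_div_sqrt hjk x)
          ((integrable_norm_slater_sq j).mul_const _) fun ζ =>
          mul_le_mul_of_nonneg_left (inv_sqrt_sq_add_sq_le_inv_abs hx _) (sq_nonneg _)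
    _ = |x|⁻¹ := by rw [integral_mul_const, integral_norm_slater_sq j, one_mul]

theorem norm_sub_sq_le_two_mul {E : Type*} [SeminormedAddCommGroup E] (a b : E) :
    ‖a - b‖ ^ 2 ≤ 2 * ‖a‖ ^ 2 + 2 * ‖b‖ ^ 2 :=
  calc ‖a - b‖ ^ 2 ≤ (‖a‖ + ‖b‖) ^ 2 := by
        gcongr
        exact norm_sub_le a b
    _ ≤ 2 * ‖a‖ ^ 2 + 2 * ‖b‖ ^ 2 := by linarith [add_sq_le (a := ‖a‖) (b := ‖b‖)]

theorem norm_slater_sq_mul_add_norm_sub_sq_le (j k : Fin N) (x : ℝ) (ζ : Fin N → ℂ) :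
    ‖slater N ζ‖ ^ 2 * (x ^ 2 + ‖ζ j - ζ k‖ ^ 2) ≤
      x ^ 2 * ‖slater N ζ‖ ^ 2 + 2 * (‖slater N ζ‖ ^ 2 * ‖ζ j‖ ^ 2) +
        2 * (‖slater N ζ‖ ^ 2 * ‖ζ k‖ ^ 2) := by
  linarith [mul_le_mul_of_nonneg_left (norm_sub_sq_le_two_mul (ζ j) (ζ k))
    (sq_nonneg ‖slater N ζ‖)]

theorem integrable_norm_slater_sq_mul_add_norm_sub_sq (j k : Fin N) (x : ℝ) :
    Integrable fun ζ : Fin N → ℂ => ‖slater N ζ‖ ^ 2 * (x ^ 2 + ‖ζ j - ζ k‖ ^ 2) := by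
  have hslater := continuous_slater N
  refine ((((integrable_norm_slater_sq j).const_mul (x ^ 2)).add
    ((integrable_norm_slater_sq_mul_pow 2 j).const_mul 2)).add
    ((integrable_norm_slater_sq_mul_pow 2 k).const_mul 2)).mono'
    (Continuous.aestronglyMeasurable (by fun_prop)) (.of_forall fun ζ => ?_)
  rw [Real.norm_of_nonneg (by positivity)]
  exact norm_slater_sq_mul_add_norm_sub_sq_le j k x ζ

theorem integral_norm_slater_sq_mul_add_norm_sub_sq_le (j k : Fin N) (x : ℝ) :
    ∫ ζ : Fin N → ℂ, ‖slater N ζ‖ ^ 2 * (x ^ 2 + ‖ζ j - ζ k‖ ^ 2) ≤ x ^ 2 + 4 * N := by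
  have hmass := (integrable_norm_slater_sq j).const_mul (x ^ 2)
  have hj := (integrable_norm_slater_sq_mul_pow 2 j).const_mul 2
  have hk := (integrable_norm_slater_sq_mul_pow 2 k).const_mul 2
  have hmass_add_j : Integrable fun ζ : Fin N → ℂ =>
      x ^ 2 * ‖slater N ζ‖ ^ 2 + 2 * (‖slater N ζ‖ ^ 2 * ‖ζ j‖ ^ 2) := hmass.add hj
  calc ∫ ζ : Fin N → ℂ, ‖slater N ζ‖ ^ 2 * (x ^ 2 + ‖ζ j - ζ k‖ ^ 2)
      ≤ ∫ ζ : Fin N → ℂ, x ^ 2 * ‖slater N ζ‖ ^ 2 + 2 * (‖slater N ζ‖ ^ 2 * ‖ζ j‖ ^ 2) +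
          2 * (‖slater N ζ‖ ^ 2 * ‖ζ k‖ ^ 2) :=
        integral_mono (integrable_norm_slater_sq_mul_add_norm_sub_sq j k x) (hmass_add_j.add hk)
          (norm_slater_sq_mul_add_norm_sub_sq_le j k x)
    _ = x ^ 2 + 2 * (∫ ζ : Fin N → ℂ, ‖slater N ζ‖ ^ 2 * ‖ζ j‖ ^ 2) +
          2 * (∫ ζ : Fin N → ℂ, ‖slater N ζ‖ ^ 2 * ‖ζ k‖ ^ 2) := by
        rw [integral_add hmass_add_j hk, integral_add hmass hj, integral_const_mul,
          integral_const_mul, integral_const_mul, integral_norm_slater_sq j, mul_one]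
    _ ≤ x ^ 2 + 4 * N := by
        linarith [integral_norm_slater_sq_mul_norm_sq_le j,
          integral_norm_slater_sq_mul_norm_sq_le k]

theorem inv_sqrt_le_effW_slater (hjk : j < k) (x : ℝ) :
    (√(x ^ 2 + 4 * N))⁻¹ ≤ effW (slater N) j k x := by
  refine inv_sqrt_le_integral_div_sqrt (fun ζ => sq_nonneg _) (integral_norm_slater_sq j)
    (fun ζ => by positivity) (fun ζ hζ => ?_) (integrable_norm_slater_sq_mul_add_norm_sub_sq j k x)
    (integrable_norm_slater_sq_div_sqrt hjk x)
    (integral_norm_slater_sq_mul_add_norm_sub_sq_le j k x)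
  have hcollision : ‖ζ j - ζ k‖ ^ 2 = 0 := by linarith [sq_nonneg x, sq_nonneg ‖ζ j - ζ k‖]
  simp [slater_eq_zero_of_eq hjk.ne (by simpa [sub_eq_zero] using hcollision)]

end EffectiveRepulsion

theorem hasCoulombBounds_slater (N : ℕ) :
    HasCoulombBounds (effV (slater N)) (effW (slater N)) where
  isBoundedMeasurable_V := isBoundedMeasurable_effV_slater
  isBoundedMeasurable_W _ _ := isBoundedMeasurable_effW_slater
  V_nonneg := effV_nonneg _
  V_le j x := by simpa using effV_slater_le j x
  le_W j k x hjk := by simpa using inv_sqrt_le_effW_slater hjk x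
  W_le _ _ _ hjk hx := effW_slater_le_inv_abs hjk hx

theorem le_of_mem_boundNumbers {Z B : ℝ} (hZ : 1 ≤ Z) (hB : 0 < B) {N : ℕ}
    (hN : N ∈ boundNumbers Z B) : (N : ℝ) ≤ 1600 * Z * (1 + Real.log (1 + √B)) := by
  have hsqrt : 0 < √B := Real.sqrt_pos.2 hB
  have hlog : 0 ≤ Real.log (1 + √B) := Real.log_nonneg (by linarith)
  have hexp : Real.exp (-(1 + Real.log (1 + √B))) ≤ B ^ (-(1 / 2) : ℝ) :=
    calc Real.exp (-(1 + Real.log (1 + √B))) ≤ Real.exp (-Real.log (1 + √B)) :=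
          Real.exp_le_exp.2 (by linarith)
      _ = (1 + √B)⁻¹ := by rw [Real.exp_neg, Real.exp_log (by positivity)]
      _ ≤ (√B)⁻¹ := inv_anti₀ hsqrt (by linarith)
      _ = B ^ (-(1 / 2) : ℝ) := by rw [Real.rpow_neg hB.le, Real.sqrt_eq_rpow]
  have hbind : ∀ i,
      formInf (B ^ (-(1 / 2) : ℝ)) (potential Z (effV (slater N)) (effW (slater N))) <
        formInf (B ^ (-(1 / 2) : ℝ)) (omitPotential Z (effV (slater N)) (effW (slater N)) i) :=
    fun i => by
      rw [← groundEnergy_eq_formInf, ← groundEnergy_omit_eq_formInf]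
      exact hN.2 i
  simpa using (hasCoulombBounds_slater N).card_le_of_bound hZ (by positivity) (by linarith) hexp
    hbind

theorem bddAbove_boundNumbers_and_Nmax_le {Z B R : ℝ} (hR : 0 ≤ R)
    (h : ∀ N ∈ boundNumbers Z B, (N : ℝ) ≤ R) :
    BddAbove (boundNumbers Z B) ∧ (Nmax Z B : ℝ) ≤ R := by
  have hbdd : BddAbove (boundNumbers Z B) := ⟨⌊R⌋₊, fun N hN => Nat.le_floor (h N hN)⟩
  refine ⟨hbdd, ?_⟩
  rcases (boundNumbers Z B).eq_empty_or_nonempty with hempty | hne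
  · simpa [Nmax, hempty] using hR
  · exact h _ (Nat.sSup_mem hne hbdd)

theorem log_one_add_sqrt_le {a b y : ℝ} (hy : 0 ≤ y) (hb : b ≤ a * Real.exp y) :
    Real.log (1 + √b) ≤ Real.log (1 + √a) + y / 2 := by
  have hsqrt : √b ≤ √a * Real.exp (y / 2) := by
    rw [Real.exp_half, ← Real.sqrt_mul' _ (Real.exp_pos y).le]
    exact Real.sqrt_le_sqrt hb
  calc Real.log (1 + √b) ≤ Real.log ((1 + √a) * Real.exp (y / 2)) := by
        refine Real.log_le_log (by positivity) ?_
        linarith [Real.one_le_exp (by positivity : 0 ≤ y / 2)]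
    _ = Real.log (1 + √a) + y / 2 := by
        rw [Real.log_mul (by positivity) (Real.exp_pos _).ne', Real.log_exp]

theorem log_one_add_sqrt_nonneg (a : ℝ) : 0 ≤ Real.log (1 + √a) :=
  Real.log_nonneg (le_add_of_nonneg_right (Real.sqrt_nonneg a))

theorem one_add_log_one_add_sqrt_le_mul_rpow {a α Z B : ℝ} (hα : 0 < α) (hZ : 1 ≤ Z)
    (hB : B ≤ a * Real.exp (Z ^ (α / 4))) :
    1 + Real.log (1 + √B) ≤ (2 + Real.log (1 + √a)) * Z ^ α := by
  have hone : 1 ≤ Z ^ α := Real.one_le_rpow hZ hα.le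
  have hquarter : Z ^ (α / 4) ≤ Z ^ α := Real.rpow_le_rpow_of_exponent_le hZ (by linarith)
  have hlog := log_one_add_sqrt_le (by positivity) hB
  linarith [mul_le_mul_of_nonneg_left hone (log_one_add_sqrt_nonneg a)]

theorem one_add_log_one_add_sqrt_mul_rpow_le {a p Z : ℝ} (hp : 0 ≤ p) (hZ : 2 ≤ Z) :
    1 + Real.log (1 + √(a * Z ^ p)) ≤
      (4 * (1 + Real.log (1 + √a)) + p) * Real.log Z ^ 2 := by
  have hlogZ : 1 / 2 ≤ Real.log Z := by
    linarith [Real.log_two_gt_d9, Real.log_le_log two_pos hZ]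
  have hlog : Real.log (1 + √(a * Z ^ p)) ≤ Real.log (1 + √a) + Real.log Z * p / 2 :=
    log_one_add_sqrt_le (by positivity) (by rw [Real.rpow_def_of_pos (by linarith)])
  have hone : 1 ≤ 4 * Real.log Z ^ 2 := by nlinarith
  have hself : Real.log Z ≤ 2 * Real.log Z ^ 2 := by nlinarith
  linarith [mul_le_mul_of_nonneg_left hself hp,
    mul_le_mul_of_nonneg_left hone (by linarith [log_one_add_sqrt_nonneg a] :
      0 ≤ 1 + Real.log (1 + √a))]

end SlaterModel

theorem mainTheorem4_general {Z B : ℝ} (hZ : 1 ≤ Z) (hB : 0 < B) :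
    BddAbove (SlaterModel.boundNumbers Z B) ∧
      (SlaterModel.Nmax Z B : ℝ) ≤ 1600 * Z * (1 + Real.log (1 + √B)) :=
  SlaterModel.bddAbove_boundNumbers_and_Nmax_le
    (mul_nonneg (by positivity) (by linarith [SlaterModel.log_one_add_sqrt_nonneg B]))
    fun _ => SlaterModel.le_of_mem_boundNumbers hZ hB

theorem mainTheorem4 :
    (∀ a₁ a₂ α : ℝ, 0 < a₁ → 0 < a₂ → 0 < α →
      ∃ A : ℝ, 0 < A ∧ ∀ ε Z B : ℝ, 0 < ε → 1 ≤ Z →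
        a₂ * Z ^ (3 + ε) ≤ B → B < a₁ * Real.exp (Z ^ (α / 4)) →
          BddAbove (SlaterModel.boundNumbers Z B) ∧
            (SlaterModel.Nmax Z B : ℝ) ≤ 4 * Z + A * Z ^ (1 + α)) ∧
    (∀ a p : ℝ, 0 < a → 3 < p →
      ∃ A : ℝ, 0 < A ∧ ∀ Z B : ℝ, 2 ≤ Z → B = a * Z ^ p →
        BddAbove (SlaterModel.boundNumbers Z B) ∧
          (SlaterModel.Nmax Z B : ℝ) ≤ 6 * Z + A * Z * Real.log Z ^ 2) := by
  refine ⟨fun a₁ a₂ α _ h₂ hα => ?_, fun a p ha hp => ?_⟩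
  · have hL := SlaterModel.log_one_add_sqrt_nonneg a₁
    refine ⟨1600 * (2 + Real.log (1 + √a₁)), by positivity, fun ε Z B _ hZ hlow hhigh => ?_⟩
    refine (mainTheorem4_general hZ (lt_of_lt_of_le (by positivity) hlow)).imp_right fun hN => ?_
    have hlog := SlaterModel.one_add_log_one_add_sqrt_le_mul_rpow hα hZ hhigh.le
    rw [Real.rpow_add (by positivity), Real.rpow_one]
    linarith [mul_le_mul_of_nonneg_left hlog (by positivity : 0 ≤ 1600 * Z)]
  · have hL := SlaterModel.log_one_add_sqrt_nonneg a
    refine ⟨1600 * (4 * (1 + Real.log (1 + √a)) + p), by positivity, fun Z B hZ hB => ?_⟩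
    obtain rfl := hB
    refine (mainTheorem4_general (by linarith) (by positivity)).imp_right fun hN => ?_
    have hlog := SlaterModel.one_add_log_one_add_sqrt_mul_rpow_le (a := a) (p := p) (by linarith) hZ
    linarith [mul_le_mul_of_nonneg_left hlog (by positivity : 0 ≤ 1600 * Z)]
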